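/- Let $\mathbb F$ be a field. A *divided power algebra* is a commutative associative (non-unital) $\mathbb F$-algebra $A$ with operations $a\mapsto a^{[n]}$ ($n\ge 1$) such that $(\lambda a)^{[n]}=\lambda^n a^{[n]}$, $a^{[m]}a^{[n]}=\binom{m+n}{m}a^{[m+n]}$, $(a+b)^{[n]}=a^{[n]}+\sum_{l=1}^{n-1}a^{[l]}b^{[n-l]}+b^{[n]}$, $a^{[1]}=a$, $(ab)^{[n]}=n!\,a^{[n]}b^{[n]}$ and $(a^{[n]})^{[m]}=\frac{(mn)!}{m!(n!)^m}a^{[mn]}$. Let $\Gamma_{\mathrm{alg}}$ be the category of these algebras and of the linear multiplicative maps that preserve the operations, and let $U(A)$ be the underlying algebra of $A$. Let $\Omega^1_A$ be the $U(A)$-module generated by symbols $\mathsf da$ ($a\in A$) under the relations $\mathsf d(a+\lambda b)=\mathsf da+\lambda\mathsf db$, $\mathsf d(ab)=a\,\mathsf db+b\,\mathsf da$, $\mathsf d(a^{[n]})=a^{[n-1]}\mathsf da$ ($n\ge 2$). Let $\Gamma^+_A$ be the left adjoint of the functor that sends a morphism $A\to B$ of $\Gamma_{\mathrm{alg}}$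 to the $U(A)$-module $B$, so that $\Gamma^+_A(M)$ is the free divided power algebra under $A$ generated by the $U(A)$-module $M$. Put $\mathsf T^\circ(A)=\Gamma^+_A(\Omega^1_A)$; it is generated by the elements $a$ and $\mathsf da$, $a\in A$. A morphism $f$ induces $\mathsf T^\circ(f)$ with $a\mapsto f(a)$, $\mathsf da\mapsto \mathsf d f(a)$. Write $a,\mathsf da,\mathsf d'a,\mathsf d'\mathsf da$ for the generators of $\mathsf T^\circ\mathsf T^\circ A$, where $\mathsf d'$ belongs to the outer $\mathsf T^\circ$. **Theorem.** The opposite category $\Gamma_{\mathrm{alg}}^{op}$ carries a Rosický tangent structure (in the sense of Cockett and Cruttwell) whose tangent bundle functor is $\mathsf T^\circ$ and whose structure maps, read in $\Gamma_{\mathrm{alg}}$, are as follows, where $\mathsf T^\circ_nA$ denotes the $n$-fold pushout of $p^\circ_A$: * projection $p^\circ_A:A\to\mathsf T^\circ A$, $a\mapsto a$; * sum $s^\circ_A:\mathsf T^\circ A\to\mathsf T^\circ_2A$, $a\mapsto a$, $\mathsf da\mapsto\mathsf d_1a+\mathsf d_2a$, where $\mathsf d_ia$ is the image of $\mathsf da$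 under the $i$-th coprojection; * zero $z^\circ_A:\mathsf T^\circ A\to A$, $a\mapsto a$, $\mathsf da\mapsto 0$; * vertical lift $l^\circ_A:\mathsf T^\circ\mathsf T^\circ A\to\mathsf T^\circ A$, $a\mapsto a$, $\mathsf da\mapsto0$, $\mathsf d'a\mapsto 0$, $\mathsf d'\mathsf da\mapsto\mathsf da$; * canonical flip $c^\circ_A:\mathsf T^\circ\mathsf T^\circ A\to\mathsf T^\circ\mathsf T^\circ A$, $a\mapsto a$, $\mathsf da\mapsto\mathsf d'a$, $\mathsf d'a\mapsto\mathsf da$, $\mathsf d'\mathsf da\mapsto\mathsf d'\mathsf da$; * negative $n^\circ_A:\mathsf T^\circ A\to\mathsf T^\circ A$, $a\mapsto a$, $\mathsf da\mapsto-\mathsf da$. It is the adjoint tangent structure of the algebraic one: $\mathsf T^\circ$ is left adjoint, with unit $a\mapsto(a,\mathsf da)$, to the functor $\mathsf T:A\mapsto A\ltimes A$, where $A\ltimes A=A\times A$ with $(a,b)(a',b')=(aa',ab'+a'b)$ and $(a,b)^{[n]}=(a^{[n]},a^{[n-1]}b)$ ($a^{[0]}b:=b$), and under this adjunction the maps above are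 the mates of $(a,b)\mapsto a$; $((a,b),(a,b'))\mapsto(a,b+b')$; $a\mapsto(a,0)$; $(a,b)\mapsto((a,0),(0,b))$; $((a,b),(c,d))\mapsto((a,c),(b,d))$; $(a,b)\mapsto(a,-b)$. -/

import Mathlib

open CategoryTheory Opposite

universe u v w

/-! ### Divided power algebras (non-unital) over a field -/

/-- A divided power structure on a commutative associative non-unital `F`-algebra `A`: operations
`a ↦ dpow n a` for `n ≥ 1`. The unused operation `dpow 0` is normalised to be zero. -/
class DPAlgebra (F : Type u) [Field F] (A : Type v) [NonUnitalCommRing A] [Module F A] where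
  dpow : ℕ → A → A
  dpow_zero : ∀ a : A, dpow 0 a = 0
  dpow_smul : ∀ (n : ℕ) (c : F) (a : A), dpow n (c • a) = c ^ n • dpow n a
  dpow_mul_dpow : ∀ (m n : ℕ) (a : A), 0 < m → 0 < n →
    dpow m a * dpow n a = (m + n).choose m • dpow (m + n) a
  dpow_add : ∀ (n : ℕ) (a b : A), 0 < n →
    dpow n (a + b) = dpow n a + ∑ l ∈ Finset.Ico 1 n, dpow l a * dpow (n - l) b + dpow n b
  dpow_one : ∀ a : A, dpow 1 a = a
  /-- The other expressions `a ^ n * b^{[n]}` and `a^{[n]} * b ^ n` of `(a * b)^{[n]}` follow from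
  `n ! • a^{[n]} = a ^ n`, see `DPAlgebra.iterate_mul` below. -/
  dpow_mul : ∀ (n : ℕ) (a b : A), 0 < n →
    dpow n (a * b) = n.factorial • (dpow n a * dpow n b)
  /-- The division of natural numbers is exact. -/
  dpow_dpow : ∀ (m n : ℕ) (a : A), 0 < m → 0 < n →
    dpow m (dpow n a) =
      ((m * n).factorial / (m.factorial * n.factorial ^ m)) • dpow (m * n) a

namespace DPAlgebra

variable (F : Type u) [Field F] {A : Type v} [NonUnitalCommRing A] [Module F A]
  [DPAlgebra F A]

/-- The action `a^{[k]} · b`, with the convention that `a^{[0]}` acts as the identity. -/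
def dpowAct (k : ℕ) (a b : A) : A := if k = 0 then b else dpow F k a * b

variable {F}

@[simp] lemma dpowAct_zero (a b : A) : dpowAct F 0 a b = b := by simp [dpowAct]

lemma dpowAct_of_pos {k : ℕ} (hk : 0 < k) (a b : A) : dpowAct F k a b = dpow F k a * b := by
  simp [dpowAct, hk.ne']

lemma dpowAct_add (k : ℕ) (a b c : A) :
    dpowAct F k a (b + c) = dpowAct F k a b + dpowAct F k a c := by
  unfold dpowAct; split_ifs <;> simp [mul_add]

lemma dpowAct_smul [SMulCommClass F A A] (k : ℕ) (r : F) (a b : A) :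
    dpowAct F k a (r • b) = r • dpowAct F k a b := by
  unfold dpowAct; split_ifs <;> simp [mul_smul_comm]

lemma dpowAct_nsmul (k n : ℕ) (a b : A) :
    dpowAct F k a (n • b) = n • dpowAct F k a b := by
  unfold dpowAct; split_ifs <;> simp [mul_smul_comm]

lemma dpowAct_mul (k : ℕ) (a b c : A) :
    dpowAct F k a (b * c) = dpowAct F k a b * c := by
  unfold dpowAct; split_ifs <;> simp [mul_assoc]

lemma dpowAct_comm (j k : ℕ) (a b c : A) :
    dpowAct F j a (dpowAct F k b c) = dpowAct F k b (dpowAct F j a c) := by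
  unfold dpowAct; split_ifs <;> simp [mul_left_comm]

lemma dpowAct_dpowAct (j k : ℕ) (a b : A) :
    dpowAct F j a (dpowAct F k a b) = (j + k).choose j • dpowAct F (j + k) a b := by
  rcases Nat.eq_zero_or_pos j with rfl | hj
  · simp
  rcases Nat.eq_zero_or_pos k with rfl | hk
  · simp
  rw [dpowAct_of_pos hj, dpowAct_of_pos hk, dpowAct_of_pos (by omega), ← mul_assoc,
    dpow_mul_dpow _ _ _ hj hk, smul_mul_assoc]

lemma dpowAct_self (k : ℕ) (a : A) : dpowAct F k a a = (k + 1) • dpow F (k + 1) a := by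
  rcases Nat.eq_zero_or_pos k with rfl | hk
  · simp [dpow_one]
  have h := dpow_mul_dpow (F := F) k 1 a hk one_pos
  rw [dpow_one] at h
  rw [dpowAct_of_pos hk, h, Nat.choose_succ_self_right]

lemma dpow_eq_of_pos {k : ℕ} (hk : 0 < k) (a b : A) : dpow F k a * b = dpowAct F k a b :=
  (dpowAct_of_pos hk a b).symm

lemma dpowAct_smul_left [IsScalarTower F A A] (k : ℕ) (r : F) (a b : A) :
    dpowAct F k (r • a) b = r ^ k • dpowAct F k a b := by
  rcases Nat.eq_zero_or_pos k with rfl | hk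
  · simp
  rw [dpowAct_of_pos hk, dpowAct_of_pos hk, dpow_smul, smul_mul_assoc]

lemma dpowAct_mul_left (k : ℕ) (a b c : A) :
    dpowAct F k (a * b) c = k.factorial • dpowAct F k a (dpowAct F k b c) := by
  rcases Nat.eq_zero_or_pos k with rfl | hk
  · simp
  simp only [dpowAct_of_pos hk]
  rw [dpow_mul _ _ _ hk, smul_mul_assoc, mul_assoc]

lemma dpowAct_add_left (k : ℕ) (a b c : A) :
    dpowAct F k (a + b) c =
      ∑ l ∈ Finset.range (k + 1), dpowAct F l a (dpowAct F (k - l) b c) := by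
  rcases Nat.eq_zero_or_pos k with rfl | hk
  · simp
  rw [dpowAct_of_pos hk, dpow_add _ _ _ hk, Finset.sum_range_succ,
    Finset.sum_range_eq_add_Ico _ hk, add_mul, add_mul, Finset.sum_mul,
    add_comm (dpow F k a * c), add_assoc, add_comm (dpow F k a * c), ← add_assoc,
    add_comm (Finset.sum _ _)]
  congr 1
  · congr 1
    · simp [dpowAct_of_pos hk]
    · refine Finset.sum_congr rfl fun l hl => ?_
      rw [Finset.mem_Ico] at hl
      rw [dpowAct_of_pos (by omega), dpowAct_of_pos (by omega), mul_assoc]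
  · simp [dpowAct_of_pos hk]

lemma mul_dpowAct (k : ℕ) (a b : A) :
    a * dpowAct F k a b = (k + 1) • dpowAct F (k + 1) a b := by
  rw [dpowAct_of_pos k.succ_pos, ← smul_mul_assoc, ← dpowAct_self, ← dpowAct_mul, mul_comm a b,
    dpowAct_mul, mul_comm]

/-- `a ^ n * b = n ! • (a^{[n]} * b)`. -/
lemma iterate_mul (n : ℕ) (a b : A) :
    (fun x => a * x)^[n] b = n.factorial • dpowAct F n a b := by
  induction n with
  | zero => simp
  | succ n ih =>
    rw [Function.iterate_succ_apply', ih, mul_smul_comm, mul_dpowAct, smul_smul,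
      Nat.factorial_succ, mul_comm]

lemma dpowAct_dpow (m n : ℕ) (a b : A) (hn : 0 < n) :
    dpowAct F m (dpow F n a) b = Nat.uniformBell m n • dpowAct F (m * n) a b := by
  rcases Nat.eq_zero_or_pos m with rfl | hm
  · simp [Nat.uniformBell_zero_left]
  rw [dpowAct_of_pos hm, dpow_dpow _ _ _ hm hn, dpowAct_of_pos (Nat.mul_pos hm hn),
    smul_mul_assoc, Nat.uniformBell_eq_div m hn.ne', mul_comm (Nat.factorial m)]

end DPAlgebra

/-! ### The tangent algebra `A ⋉ A` (semidirect product with trivial `p`-map) -/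

/-- The semidirect product `A ⋉ A`, with product `(a, b) * (a', b') = (a * a', a * b' + a' * b)` and
divided powers `(a, b)^{[n]} = (a^{[n]}, a^{[n-1]} * b)`, where `a^{[0]}` acts as the identity. -/
def Semidirect (A : Type v) : Type v := A × A

namespace Semidirect

section Ring

variable {A : Type v} [NonUnitalCommRing A]

instance : AddCommGroup (Semidirect A) := inferInstanceAs (AddCommGroup (A × A))

instance {F : Type u} [Field F] [Module F A] : Module F (Semidirect A) :=
  inferInstanceAs (Module F (A × A))

instance : Mul (Semidirect A) := ⟨fun x y => (x.1 * y.1, x.1 * y.2 + y.1 * x.2)⟩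

@[ext] lemma ext {x y : Semidirect A} (h₁ : x.1 = y.1) (h₂ : x.2 = y.2) : x = y := Prod.ext h₁ h₂

@[simp] lemma fst_mul (x y : Semidirect A) : (x * y).1 = x.1 * y.1 := rfl
@[simp] lemma snd_mul (x y : Semidirect A) : (x * y).2 = x.1 * y.2 + y.1 * x.2 := rfl
@[simp] lemma fst_add (x y : Semidirect A) : (x + y).1 = x.1 + y.1 := rfl
@[simp] lemma snd_add (x y : Semidirect A) : (x + y).2 = x.2 + y.2 := rfl
@[simp] lemma fst_zero : (0 : Semidirect A).1 = 0 := rfl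
@[simp] lemma snd_zero : (0 : Semidirect A).2 = 0 := rfl
@[simp] lemma fst_smul {F : Type u} [Field F] [Module F A] (c : F) (x : Semidirect A) :
    (c • x).1 = c • x.1 := rfl
@[simp] lemma snd_smul {F : Type u} [Field F] [Module F A] (c : F) (x : Semidirect A) :
    (c • x).2 = c • x.2 := rfl
@[simp] lemma fst_nsmul (n : ℕ) (x : Semidirect A) : (n • x).1 = n • x.1 := rfl
@[simp] lemma snd_nsmul (n : ℕ) (x : Semidirect A) : (n • x).2 = n • x.2 := rfl

lemma fst_sum {ι : Type*} (s : Finset ι) (f : ι → Semidirect A) :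
    (∑ i ∈ s, f i).1 = ∑ i ∈ s, (f i).1 := Prod.fst_sum (f := f) (s := s)

lemma snd_sum {ι : Type*} (s : Finset ι) (f : ι → Semidirect A) :
    (∑ i ∈ s, f i).2 = ∑ i ∈ s, (f i).2 := Prod.snd_sum (f := f) (s := s)

instance : NonUnitalCommRing (Semidirect A) where
  left_distrib x y z := by
    ext
    · simp [mul_add]
    · simp only [snd_mul, fst_add, snd_add, mul_add, add_mul]; abel
  right_distrib x y z := by
    ext
    · simp [add_mul]
    · simp only [snd_mul, fst_add, snd_add, mul_add, add_mul]; abel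
  zero_mul x := by ext <;> simp
  mul_zero x := by ext <;> simp
  mul_assoc x y z := by
    ext
    · simp [mul_assoc]
    · simp only [snd_mul, fst_mul, mul_add, mul_assoc]
      rw [mul_left_comm z.1 x.1 y.2, mul_left_comm z.1 y.1 x.2, mul_comm z.1 y.2,
        mul_comm z.1 x.2, add_assoc, mul_comm y.2 z.1]
  mul_comm x y := by ext <;> simp [mul_comm, add_comm]

end Ring

variable {F : Type u} [Field F] {A : Type v} [NonUnitalCommRing A] [Module F A]
  [IsScalarTower F A A] [SMulCommClass F A A]

instance : IsScalarTower F (Semidirect A) (Semidirect A) :=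
  ⟨fun c x y => by ext <;> simp [smul_mul_assoc, mul_smul_comm]⟩

instance : SMulCommClass F (Semidirect A) (Semidirect A) :=
  ⟨fun c x y => by ext <;> simp [smul_mul_assoc, mul_smul_comm]⟩

open DPAlgebra

/-- The `n`-th divided power `(a^{[n]}, a^{[n-1]} * b)` of `(a, b)`, for `n ≥ 1`. -/
def dp [DPAlgebra F A] (n : ℕ) (x : Semidirect A) : Semidirect A :=
  if n = 0 then 0 else (dpow F n x.1, dpowAct F (n - 1) x.1 x.2)

variable [DPAlgebra F A]

@[simp] lemma fst_dp (n : ℕ) (x : Semidirect A) : (dp (F := F) n x).1 = dpow F n x.1 := by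
  rcases n with _ | n
  · simp [dp, dpow_zero]
  · rfl

@[simp] lemma snd_dp_succ (n : ℕ) (x : Semidirect A) :
    (dp (F := F) (n + 1) x).2 = dpowAct F n x.1 x.2 := rfl

instance : DPAlgebra F (Semidirect A) where
  dpow n x := dp (F := F) n x
  dpow_zero x := by simp [dp]
  dpow_smul n c x := by
    rcases n with _ | n
    · simp [dp]
    · ext
      · simp [dpow_smul]
      · simp [dpowAct_smul_left, dpowAct_smul, smul_smul, pow_succ, mul_comm]
  dpow_mul_dpow m n x hm hn := by
    obtain ⟨m, rfl⟩ := Nat.exists_eq_succ_of_ne_zero hm.ne'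
    obtain ⟨n, rfl⟩ := Nat.exists_eq_succ_of_ne_zero hn.ne'
    ext
    · simp [dpow_mul_dpow]
    · have e : m.succ + n.succ = m + n + 1 + 1 := by omega
      simp only [Nat.succ_eq_add_one] at e ⊢
      rw [snd_mul, fst_dp, fst_dp, snd_dp_succ, snd_dp_succ, snd_nsmul, e, snd_dp_succ,
        dpow_eq_of_pos (by omega), dpow_eq_of_pos (by omega), dpowAct_dpowAct, dpowAct_dpowAct,
        show m + 1 + n = m + n + 1 by omega, show n + 1 + m = m + n + 1 by omega, ← add_smul]
      congr 1
      rw [Nat.choose_succ_succ' (m + n + 1) m, add_comm]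
      congr 1
      rw [← Nat.choose_symm_of_eq_add (show m + n + 1 = m + (n + 1) by omega)]
  dpow_add n x y hn := by
    obtain ⟨n, rfl⟩ := Nat.exists_eq_succ_of_ne_zero hn.ne'
    ext
    · simp [dpow_add _ _ _ hn, fst_sum]
    · simp only [Nat.succ_eq_add_one, snd_add, snd_sum, snd_mul, fst_dp, snd_dp_succ, fst_add]
      have h₁ : dpowAct F n (x.1 + y.1) y.2 = dpowAct F n y.1 y.2 +
          ∑ l ∈ Finset.Ico 1 (n + 1), dpow F l x.1 * (dp (F := F) (n + 1 - l) y).2 := by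
        rw [dpowAct_add_left, Finset.sum_range_eq_add_Ico _ n.succ_pos]
        simp only [dpowAct_zero, Nat.sub_zero]
        congr 1
        refine Finset.sum_congr rfl fun l hl => ?_
        rw [Finset.mem_Ico] at hl
        rw [show n + 1 - l = n - l + 1 by omega, snd_dp_succ, dpow_eq_of_pos (by omega)]
      have h₂ : dpowAct F n (x.1 + y.1) x.2 = dpowAct F n x.1 x.2 +
          ∑ l ∈ Finset.Ico 1 (n + 1), dpow F (n + 1 - l) y.1 * (dp (F := F) l x).2 := by
        rw [dpowAct_add_left, Finset.sum_range_succ, add_comm, Finset.sum_Ico_eq_sum_range]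
        simp only [dpowAct_zero, Nat.sub_self, Nat.add_sub_cancel]
        congr 1
        refine Finset.sum_congr rfl fun l hl => ?_
        rw [Finset.mem_range] at hl
        rw [show n + 1 - (1 + l) = n - l by omega, add_comm 1 l, snd_dp_succ,
          dpow_eq_of_pos (by omega), dpowAct_comm]
      rw [Finset.sum_add_distrib, dpowAct_add, h₁, h₂]
      abel
  dpow_one x := by ext <;> simp [dpow_one, dp]
  dpow_mul n x y hn := by
    obtain ⟨n, rfl⟩ := Nat.exists_eq_succ_of_ne_zero hn.ne'
    ext
    · simp [dpow_mul]
    · simp only [Nat.succ_eq_add_one, snd_mul, fst_mul, snd_dp_succ, fst_dp, snd_nsmul]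
      have h (a a' b : A) : dpowAct F n a (dpowAct F n a' (a * b)) =
          (n + 1) • (dpow F (n + 1) a * dpowAct F n a' b) := by
        rw [mul_comm a b, dpowAct_mul, dpowAct_mul, mul_comm, mul_dpowAct,
          dpowAct_of_pos n.succ_pos]
      rw [dpowAct_mul_left, dpowAct_add, dpowAct_add, h, dpowAct_comm, h, ← smul_add, smul_smul,
        Nat.factorial_succ, mul_comm]
  dpow_dpow m n x hm hn := by
    obtain ⟨m, rfl⟩ := Nat.exists_eq_succ_of_ne_zero hm.ne'
    obtain ⟨n, rfl⟩ := Nat.exists_eq_succ_of_ne_zero hn.ne'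
    ext
    · simp [dpow_dpow]
    · have e : m.succ * n.succ = m * (n + 1) + n + 1 := by
        simp only [Nat.succ_eq_add_one]; ring
      rw [mul_comm (Nat.factorial _), ← Nat.uniformBell_eq_div _ hn.ne', e]
      simp only [Nat.succ_eq_add_one, fst_dp, snd_dp_succ, snd_nsmul]
      rw [dpowAct_dpow _ _ _ _ n.succ_pos, dpowAct_dpowAct, smul_smul, Nat.uniformBell_succ_left,
        mul_comm]
      congr 2
      exact Nat.choose_symm_of_eq_add (by omega)

end Semidirect

/-! ### The category of divided power algebras -/

/-- Morphisms of divided power algebras: `F`-linear multiplicative maps commuting with all divided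
power operations. -/
structure DPHom (F : Type u) [Field F] (A : Type v) (B : Type w)
    [NonUnitalCommRing A] [Module F A] [DPAlgebra F A]
    [NonUnitalCommRing B] [Module F B] [DPAlgebra F B] extends A →ₗ[F] B where
  map_mul' : ∀ a b : A, toFun (a * b) = toFun a * toFun b
  map_dpow' : ∀ (n : ℕ) (a : A), 0 < n →
    toFun (DPAlgebra.dpow F n a) = DPAlgebra.dpow F n (toFun a)

namespace DPHom

variable {F : Type u} [Field F] {A B C : Type*}
  [NonUnitalCommRing A] [Module F A] [DPAlgebra F A]
  [NonUnitalCommRing B] [Module F B] [DPAlgebra F B]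
  [NonUnitalCommRing C] [Module F C] [DPAlgebra F C]

instance : FunLike (DPHom F A B) A B where
  coe f := f.toFun
  coe_injective f g h := by
    obtain ⟨⟨⟨f, _⟩, _⟩, _, _⟩ := f
    obtain ⟨⟨⟨g, _⟩, _⟩, _, _⟩ := g
    congr

instance : LinearMapClass (DPHom F A B) F A B where
  map_add f := f.map_add'
  map_smulₛₗ f := f.map_smul'

@[ext] lemma ext {f g : DPHom F A B} (h : ∀ a, f a = g a) : f = g := DFunLike.ext f g h

lemma map_mul (f : DPHom F A B) (a b : A) : f (a * b) = f a * f b := f.map_mul' a b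

lemma map_dpow (f : DPHom F A B) (n : ℕ) (a : A) :
    f (DPAlgebra.dpow F n a) = DPAlgebra.dpow F n (f a) := by
  rcases Nat.eq_zero_or_pos n with rfl | hn
  · simp [DPAlgebra.dpow_zero]
  · exact f.map_dpow' n a hn

/-- The identity morphism. -/
def id (F : Type u) [Field F] (A : Type v) [NonUnitalCommRing A] [Module F A] [DPAlgebra F A] :
    DPHom F A A where
  __ := LinearMap.id
  map_mul' _ _ := rfl
  map_dpow' _ _ _ := rfl

/-- Composition of morphisms. -/
def comp (g : DPHom F B C) (f : DPHom F A B) : DPHom F A C where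
  __ := g.toLinearMap.comp f.toLinearMap
  map_mul' a b := by
    change g (f (a * b)) = g (f a) * g (f b)
    rw [f.map_mul, g.map_mul]
  map_dpow' n a _ := by
    change g (f _) = DPAlgebra.dpow F n (g (f a))
    rw [f.map_dpow, g.map_dpow]

@[simp] lemma id_apply (a : A) : DPHom.id F A a = a := rfl

@[simp] lemma comp_apply (g : DPHom F B C) (f : DPHom F A B) (a : A) : g.comp f a = g (f a) := rfl

end DPHom

/-- The category of divided power algebras over the field `F`: objects. -/
structure DPAlg (F : Type u) [Field F] where
  carrier : Type u
  [ring : NonUnitalCommRing carrier]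
  [module : Module F carrier]
  [tower : IsScalarTower F carrier carrier]
  [comm : SMulCommClass F carrier carrier]
  [dp : DPAlgebra F carrier]

namespace DPAlg

variable (F : Type u) [Field F]

attribute [instance] ring module tower comm dp

instance : CoeSort (DPAlg F) (Type u) := ⟨carrier⟩

instance : Category (DPAlg F) where
  Hom A B := DPHom F A B
  id A := DPHom.id F A
  comp f g := g.comp f

instance : ConcreteCategory (DPAlg F) (fun A B => DPHom F A B) where
  hom f := f
  ofHom f := f

end DPAlg

/-- The morphism `f ⋉ f`, `(a, b) ↦ (f a, f b)`. -/
def Semidirect.map {F : Type u} [Field F] {A : Type v} {B : Type w}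
    [NonUnitalCommRing A] [Module F A] [IsScalarTower F A A] [SMulCommClass F A A] [DPAlgebra F A]
    [NonUnitalCommRing B] [Module F B] [IsScalarTower F B B] [SMulCommClass F B B] [DPAlgebra F B]
    (f : DPHom F A B) : DPHom F (Semidirect A) (Semidirect B) where
  toFun x := (f x.1, f x.2)
  map_add' x y := Semidirect.ext (map_add f _ _) (map_add f _ _)
  map_smul' c x := Semidirect.ext (map_smul f _ _) (map_smul f _ _)
  map_mul' x y := Semidirect.ext (f.map_mul _ _) (by
    change f (x.1 * y.2 + y.1 * x.2) = f x.1 * f y.2 + f y.1 * f x.2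
    rw [map_add, f.map_mul, f.map_mul])
  map_dpow' n x hn := by
    obtain ⟨n, rfl⟩ := Nat.exists_eq_succ_of_ne_zero hn.ne'
    refine Semidirect.ext (f.map_dpow _ _) ?_
    change f (DPAlgebra.dpowAct F n x.1 x.2) = DPAlgebra.dpowAct F n (f x.1) (f x.2)
    unfold DPAlgebra.dpowAct
    split_ifs
    · rfl
    · rw [f.map_mul, f.map_dpow]

/-- The algebraic tangent functor `A ↦ A ⋉ A` on divided power algebras. -/
def algTangent (F : Type u) [Field F] : DPAlg F ⥤ DPAlg F where
  obj A := ⟨Semidirect A⟩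
  map {A B} f := Semidirect.map (A := A) (B := B) f

/-! ### Modules over the underlying non-unital algebra

Modules over a non-unital `F`-algebra `A` (vector spaces with an associative bilinear action of `A`)
are the same as modules over its unitization `F ⊕ A`. -/

/-- For a morphism `f : A → B`, the algebra `B` seen as a `U(A)`-module through `f`. -/
def DPHom.Restrict {F : Type u} [Field F] {A : Type v} {B : Type w}
    [NonUnitalCommRing A] [Module F A] [DPAlgebra F A]
    [NonUnitalCommRing B] [Module F B] [DPAlgebra F B] (_f : DPHom F A B) : Type w := B

namespace DPHom.Restrict

variable {F : Type u} [Field F] {A : Type v} {B : Type w}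
    [NonUnitalCommRing A] [Module F A] [IsScalarTower F A A] [SMulCommClass F A A] [DPAlgebra F A]
    [NonUnitalCommRing B] [Module F B] [IsScalarTower F B B] [SMulCommClass F B B] [DPAlgebra F B]
    (f : DPHom F A B)

instance : AddCommGroup f.Restrict := inferInstanceAs (AddCommGroup B)

/-- The identity map from `B` to `B` seen as a `U(A)`-module. -/
def of : B ≃+ f.Restrict := AddEquiv.refl B

instance : Module (Unitization F A) f.Restrict where
  smul r b := of f (r.fst • (of f).symm b + f r.snd * (of f).symm b)
  one_smul b := by
    change (1 : Unitization F A).fst • (of f).symm b + f (1 : Unitization F A).snd * (of f).symm b = (of f).symm b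
    simp
  mul_smul r s b := by
    change (r * s).fst • (of f).symm b + f (r * s).snd * (of f).symm b =
      r.fst • (s.fst • (of f).symm b + f s.snd * (of f).symm b) +
        f r.snd * (s.fst • (of f).symm b + f s.snd * (of f).symm b)
    simp only [Unitization.fst_mul, Unitization.snd_mul, map_add, map_smul, f.map_mul, add_mul,
      mul_add, smul_add, smul_mul_assoc, mul_smul_comm, mul_smul, mul_assoc]
    abel
  smul_zero r := by
    change r.fst • (0 : B) + f r.snd * (0 : B) = 0
    simp
  smul_add r b c := by
    change r.fst • ((of f).symm b + (of f).symm c) + f r.snd * ((of f).symm b + (of f).symm c) =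
      (r.fst • (of f).symm b + f r.snd * (of f).symm b) + (r.fst • (of f).symm c + f r.snd * (of f).symm c)
    simp only [smul_add, mul_add]
    abel
  add_smul r s b := by
    change (r + s).fst • (of f).symm b + f (r + s).snd * (of f).symm b =
      (r.fst • (of f).symm b + f r.snd * (of f).symm b) + (s.fst • (of f).symm b + f s.snd * (of f).symm b)
    simp only [Unitization.fst_add, Unitization.snd_add, add_smul, map_add, add_mul]
    abel
  zero_smul b := by
    change (0 : Unitization F A).fst • (of f).symm b + f (0 : Unitization F A).snd * (of f).symm b = 0
    simp

lemma smul_def (r : Unitization F A) (b : f.Restrict) :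
    (of f).symm (r • b) = r.fst • (of f).symm b + f r.snd * (of f).symm b := rfl

end DPHom.Restrict

/-! ### The free divided power `A`-algebra on a `U(A)`-module -/

section Free

variable (F : Type u) [Field F] (A : Type u) [NonUnitalCommRing A] [Module F A]
  [IsScalarTower F A A] [SMulCommClass F A A] [DPAlgebra F A]
  (M : Type u) [AddCommGroup M] [Module (Unitization F A) M]

/-- Formal divided power expressions in the elements of `A` and of `M`. -/
inductive DPTerm : Type u
  | ofAlg : A → DPTerm
  | ofMod : M → DPTerm
  | zero : DPTerm
  | add : DPTerm → DPTerm → DPTerm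
  | neg : DPTerm → DPTerm
  | smul : F → DPTerm → DPTerm
  | mul : DPTerm → DPTerm → DPTerm
  | dpow : ℕ → DPTerm → DPTerm

/-- A divided power `A`-algebra `f : A → B` together with a `U(A)`-linear map `g : M → B`. -/
structure DPTarget where
  B : DPAlg.{u} F
  f : DPHom F A B
  g : M →ₗ[Unitization F A] f.Restrict

variable {F A M}

/-- The value of a formal expression in a divided power `A`-algebra equipped with a `U(A)`-linear
map from `M`. -/
def DPTerm.eval (X : DPTarget F A M) : DPTerm F A M → X.B
  | ofAlg a => X.f a
  | ofMod m => (DPHom.Restrict.of X.f).symm (X.g m)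
  | zero => 0
  | add s t => s.eval X + t.eval X
  | neg s => - s.eval X
  | smul c s => c • s.eval X
  | mul s t => s.eval X * t.eval X
  | dpow n s => DPAlgebra.dpow F n (s.eval X)

variable (F A M)

/-- Two formal expressions are identified when they take the same value in every divided power
`A`-algebra with a `U(A)`-linear map from `M`. -/
def DPTerm.setoid : Setoid (DPTerm F A M) where
  r s t := ∀ X : DPTarget F A M, s.eval X = t.eval X
  iseqv := ⟨fun _ _ => rfl, fun h X => (h X).symm, fun h k X => (h X).trans (k X)⟩

/-- The free divided power `A`-algebra `Γ⁺_A(M)` generated by the `U(A)`-module `M`, i.e. the value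
at `M` of the left adjoint of the functor sending a divided power `A`-algebra `f : A → B` to the
`U(A)`-module `B`; see `FreeDP.lift` and `FreeDP.hom_ext` for its universal property. -/
def FreeDP : Type u := Quotient (DPTerm.setoid F A M)

namespace FreeDP

variable {F A M}

/-- The class of a formal expression. -/
def mk (t : DPTerm F A M) : FreeDP F A M := Quotient.mk _ t

/-- Evaluation of elements of `Γ⁺_A(M)`. -/
def eval (X : DPTarget F A M) : FreeDP F A M → X.B :=
  Quotient.lift (DPTerm.eval X) fun _ _ h => h X

@[simp] lemma eval_mk (X : DPTarget F A M) (t : DPTerm F A M) : eval X (mk t) = t.eval X := rfl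

lemma eval_ext {x y : FreeDP F A M} (h : ∀ X : DPTarget F A M, eval X x = eval X y) : x = y := by
  induction x using Quotient.inductionOn
  induction y using Quotient.inductionOn
  exact Quotient.sound h

instance : Zero (FreeDP F A M) := ⟨mk .zero⟩
instance : Add (FreeDP F A M) :=
  ⟨Quotient.map₂ .add fun _ _ h _ _ k X => congrArg₂ (· + ·) (h X) (k X)⟩
instance : Neg (FreeDP F A M) := ⟨Quotient.map .neg fun _ _ h X => congrArg (- ·) (h X)⟩
instance : Mul (FreeDP F A M) :=
  ⟨Quotient.map₂ .mul fun _ _ h _ _ k X => congrArg₂ (· * ·) (h X) (k X)⟩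
instance : SMul F (FreeDP F A M) :=
  ⟨fun c => Quotient.map (.smul c) fun _ _ h X => congrArg (c • ·) (h X)⟩

/-- The divided power operations of `Γ⁺_A(M)`. -/
def dp (n : ℕ) : FreeDP F A M → FreeDP F A M :=
  Quotient.map (.dpow n) fun _ _ h X => congrArg (DPAlgebra.dpow F n) (h X)

section

variable (X : DPTarget F A M) (x y : FreeDP F A M)

@[simp] lemma eval_zero : eval X 0 = 0 := rfl

@[simp] lemma eval_add : eval X (x + y) = eval X x + eval X y := by
  induction x using Quotient.inductionOn
  induction y using Quotient.inductionOn
  rfl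

@[simp] lemma eval_neg : eval X (-x) = - eval X x := by
  induction x using Quotient.inductionOn
  rfl

@[simp] lemma eval_mul : eval X (x * y) = eval X x * eval X y := by
  induction x using Quotient.inductionOn
  induction y using Quotient.inductionOn
  rfl

@[simp] lemma eval_smul (c : F) : eval X (c • x) = c • eval X x := by
  induction x using Quotient.inductionOn
  rfl

@[simp] lemma eval_dp (n : ℕ) : eval X (dp n x) = DPAlgebra.dpow F n (eval X x) := by
  induction x using Quotient.inductionOn
  rfl

end

instance : NonUnitalCommRing (FreeDP F A M) where
  add_assoc x y z := eval_ext fun X => by simp [add_assoc]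
  zero_add x := eval_ext fun X => by simp
  add_zero x := eval_ext fun X => by simp
  add_comm x y := eval_ext fun X => by simp [add_comm]
  neg_add_cancel x := eval_ext fun X => by simp
  mul_assoc x y z := eval_ext fun X => by simp [mul_assoc]
  mul_comm x y := eval_ext fun X => by simp [mul_comm]
  left_distrib x y z := eval_ext fun X => by simp [mul_add]
  right_distrib x y z := eval_ext fun X => by simp [add_mul]
  zero_mul x := eval_ext fun X => by simp
  mul_zero x := eval_ext fun X => by simp
  nsmul := nsmulRec
  zsmul := zsmulRec

instance : Module F (FreeDP F A M) where
  one_smul x := eval_ext fun X => by simp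
  mul_smul c d x := eval_ext fun X => by simp [mul_smul]
  smul_zero c := eval_ext fun X => by simp
  smul_add c x y := eval_ext fun X => by simp
  add_smul c d x := eval_ext fun X => by simp [add_smul]
  zero_smul x := eval_ext fun X => by simp

instance : IsScalarTower F (FreeDP F A M) (FreeDP F A M) :=
  ⟨fun c x y => eval_ext fun X => by simp [smul_mul_assoc]⟩

instance : SMulCommClass F (FreeDP F A M) (FreeDP F A M) :=
  ⟨fun c x y => eval_ext fun X => by simp [mul_smul_comm]⟩

/-- Evaluation is linear. -/
def evalₗ (X : DPTarget F A M) : FreeDP F A M →ₗ[F] X.B where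
  toFun := eval X
  map_add' := eval_add X
  map_smul' c x := eval_smul X x c

lemma eval_nsmul (X : DPTarget F A M) (n : ℕ) (x : FreeDP F A M) :
    eval X (n • x) = n • eval X x := map_nsmul (evalₗ X) n x

lemma eval_sum (X : DPTarget F A M) {ι : Type*} (s : Finset ι) (x : ι → FreeDP F A M) :
    eval X (∑ i ∈ s, x i) = ∑ i ∈ s, eval X (x i) := map_sum (evalₗ X) x s

instance : DPAlgebra F (FreeDP F A M) where
  dpow := dp
  dpow_zero x := eval_ext fun X => by simp [DPAlgebra.dpow_zero]
  dpow_smul n c x := eval_ext fun X => by simp [DPAlgebra.dpow_smul]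
  dpow_mul_dpow m n x hm hn := eval_ext fun X => by
    simp [DPAlgebra.dpow_mul_dpow _ _ _ hm hn, eval_nsmul]
  dpow_add n x y hn := eval_ext fun X => by simp [DPAlgebra.dpow_add _ _ _ hn, eval_sum]
  dpow_one x := eval_ext fun X => by simp [DPAlgebra.dpow_one]
  dpow_mul n x y hn := eval_ext fun X => by
    simp [DPAlgebra.dpow_mul _ _ _ hn, eval_nsmul]
  dpow_dpow m n x hm hn := eval_ext fun X => by
    simp only [eval_dp, DPAlgebra.dpow_dpow _ _ _ hm hn, eval_nsmul]

variable (F A M)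

/-- The structure morphism `A → Γ⁺_A(M)`. -/
def incl : DPHom F A (FreeDP F A M) where
  toFun a := mk (.ofAlg a)
  map_add' a b := eval_ext fun X => by simp [DPTerm.eval]
  map_smul' c a := eval_ext fun X => by simp [DPTerm.eval]
  map_mul' a b := eval_ext fun X => by simp [DPTerm.eval, X.f.map_mul]
  map_dpow' n a _ := eval_ext fun X => (X.f.map_dpow n a).trans (eval_dp X (mk (.ofAlg a)) n).symm

/-- The universal `U(A)`-linear map `M → Γ⁺_A(M)`. -/
def gen : M →ₗ[Unitization F A] (incl F A M).Restrict where
  toFun m := DPHom.Restrict.of _ (mk (.ofMod m))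
  map_add' m n := eval_ext fun X => by
    change (DPHom.Restrict.of X.f).symm (X.g (m + n)) = eval X (mk (.ofMod m) + mk (.ofMod n))
    rw [map_add, map_add]
    exact (eval_add X (mk (.ofMod m)) (mk (.ofMod n))).symm
  map_smul' r m := eval_ext fun X => by
    change (DPHom.Restrict.of X.f).symm (X.g (r • m)) =
      eval X (r.fst • mk (.ofMod m) + incl F A M r.snd * mk (.ofMod m))
    rw [map_smul, DPHom.Restrict.smul_def, eval_add, eval_smul, eval_mul]
    rfl

variable {F A M}

/-- The morphism of divided power algebras `Γ⁺_A(M) → B` induced by a morphism `f : A → B` of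
divided power algebras and a `U(A)`-linear map `g : M → B`. -/
def lift {B : Type u} [NonUnitalCommRing B] [Module F B]
    [IsScalarTower F B B] [SMulCommClass F B B] [DPAlgebra F B] (f : DPHom F A B) (g : M →ₗ[Unitization F A] f.Restrict) :
    DPHom F (FreeDP F A M) B where
  __ := evalₗ (⟨⟨B⟩, f, g⟩ : DPTarget F A M)
  map_mul' := eval_mul _
  map_dpow' n x _ := eval_dp _ x n

@[simp] lemma lift_incl {B : Type u} [NonUnitalCommRing B] [Module F B]
    [IsScalarTower F B B] [SMulCommClass F B B] [DPAlgebra F B] (f : DPHom F A B)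
    (g : M →ₗ[Unitization F A] f.Restrict) (a : A) : lift f g (incl F A M a) = f a := rfl

@[simp] lemma lift_gen {B : Type u} [NonUnitalCommRing B] [Module F B]
    [IsScalarTower F B B] [SMulCommClass F B B] [DPAlgebra F B] (f : DPHom F A B)
    (g : M →ₗ[Unitization F A] f.Restrict) (m : M) :
    lift f g ((DPHom.Restrict.of _).symm (gen F A M m)) = (DPHom.Restrict.of _).symm (g m) := rfl

lemma hom_ext {B : Type u} [NonUnitalCommRing B] [Module F B]
    [IsScalarTower F B B] [SMulCommClass F B B] [DPAlgebra F B] {h k : DPHom F (FreeDP F A M) B}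
    (h₁ : ∀ a, h (incl F A M a) = k (incl F A M a))
    (h₂ : ∀ m, h ((DPHom.Restrict.of _).symm (gen F A M m)) =
      k ((DPHom.Restrict.of _).symm (gen F A M m))) : h = k := by
  ext x
  induction x using Quotient.inductionOn with | _ t
  change h (mk t) = k (mk t)
  induction t with
  | ofAlg a => exact h₁ a
  | ofMod m => exact h₂ m
  | zero => exact (map_zero h).trans (map_zero k).symm
  | add s t hs ht =>
    change h (mk s + mk t) = k (mk s + mk t)
    rw [map_add, map_add, hs, ht]
  | neg s hs =>
    change h (-mk s) = k (-mk s)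
    rw [map_neg, map_neg, hs]
  | smul c s hs =>
    change h (c • mk s) = k (c • mk s)
    rw [map_smul, map_smul, hs]
  | mul s t hs ht =>
    change h (mk s * mk t) = k (mk s * mk t)
    rw [h.map_mul, k.map_mul, hs, ht]
  | dpow n s hs =>
    change h (DPAlgebra.dpow F n (mk s)) = k (DPAlgebra.dpow F n (mk s))
    rw [h.map_dpow, k.map_dpow, hs]

end FreeDP

end Free

/-! ### Strongly abelian Kähler differentials and the geometric tangent functor -/

section Kaehler

variable (F : Type u) [Field F] (A : Type u) [NonUnitalCommRing A] [Module F A]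
  [IsScalarTower F A A] [SMulCommClass F A A] [DPAlgebra F A]

/-- The relations defining Kähler differentials in the free `U(A)`-module on symbols `d a`,
`a ∈ A`: the `F`-linearity of `d` and the Leibniz rule. -/
def kaehlerRelations : Set (A →₀ Unitization F A) :=
  {x | ∃ (c : F) (a b : A), x = Finsupp.single (a + c • b) 1 -
    (Finsupp.single a 1 + Finsupp.single b (Unitization.inl c))} ∪
  {x | ∃ a b : A, x = Finsupp.single (a * b) 1 -
    (Finsupp.single b (Unitization.inr a) + Finsupp.single a (Unitization.inr b))}

/-- The `U(A)`-module `Ω_{U(A)}` of Kähler differentials of the underlying algebra `U(A)`. -/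
noncomputable abbrev KaehlerU : Type u :=
  (A →₀ Unitization F A) ⧸ Submodule.span (Unitization F A) (kaehlerRelations F A)

/-- The universal derivation `A → Ω_{U(A)}`. -/
noncomputable def dU (a : A) : KaehlerU F A := Submodule.Quotient.mk (Finsupp.single a 1)

/-- The relations `d (a^{[n]}) - a^{[n-1]} d a` in `Ω_{U(A)}`; for `n = 1` this is trivial. -/
def dpRelations : Set (KaehlerU F A) :=
  {x | ∃ (n : ℕ) (a : A), 2 ≤ n ∧ x = dU F A (DPAlgebra.dpow F n a) -
    (Unitization.inr (DPAlgebra.dpow F (n - 1) a) : Unitization F A) • dU F A a}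

/-- The `U(A)`-module `Ω¹_A` of strongly abelian Kähler differentials. -/
noncomputable abbrev Omega : Type u :=
  KaehlerU F A ⧸ Submodule.span (Unitization F A) (dpRelations F A)

/-- The class of `d a` in `Ω¹_A`. -/
noncomputable def dOmega (a : A) : Omega F A := Submodule.Quotient.mk (dU F A a)

variable {F A}

lemma dOmega_add_smul (c : F) (a b : A) :
    dOmega F A (a + c • b) = dOmega F A a + (Unitization.inl c : Unitization F A) • dOmega F A b := by
  refine congrArg (Submodule.Quotient.mk) ((Submodule.Quotient.eq _).2 (?_ : _ ∈ _))
  refine Submodule.subset_span (Or.inl ⟨c, a, b, ?_⟩)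
  simp

lemma dOmega_mul (a b : A) :
    dOmega F A (a * b) = (Unitization.inr a : Unitization F A) • dOmega F A b +
      (Unitization.inr b : Unitization F A) • dOmega F A a := by
  refine congrArg (Submodule.Quotient.mk) ((Submodule.Quotient.eq _).2 (?_ : _ ∈ _))
  refine Submodule.subset_span (Or.inr ⟨a, b, ?_⟩)
  simp

lemma dOmega_dpow (n : ℕ) (hn : 2 ≤ n) (a : A) :
    dOmega F A (DPAlgebra.dpow F n a) =
      (Unitization.inr (DPAlgebra.dpow F (n - 1) a) : Unitization F A) • dOmega F A a :=
  (Submodule.Quotient.eq _).2 (Submodule.subset_span ⟨n, a, hn, rfl⟩)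

/-- The `U(A)`-linear map `Ω¹_A → N` induced by a map `D : A → N` satisfying the defining relations
of `Ω¹_A`. -/
noncomputable def Omega.lift {N : Type*} [AddCommGroup N] [Module (Unitization F A) N] (D : A → N)
    (h₁ : ∀ (c : F) (a b : A), D (a + c • b) = D a + (Unitization.inl c : Unitization F A) • D b)
    (h₂ : ∀ a b : A, D (a * b) = (Unitization.inr a : Unitization F A) • D b +
      (Unitization.inr b : Unitization F A) • D a)
    (h₃ : ∀ (n : ℕ) (a : A), 2 ≤ n → D (DPAlgebra.dpow F n a) =
      (Unitization.inr (DPAlgebra.dpow F (n - 1) a) : Unitization F A) • D a) :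
    Omega F A →ₗ[Unitization F A] N :=
  Submodule.liftQ _
    (Submodule.liftQ _ (Finsupp.linearCombination (Unitization F A) D) (by
      rw [Submodule.span_le]
      rintro x (⟨c, a, b, rfl⟩ | ⟨a, b, rfl⟩)
      · simp [h₁]
      · simp [h₂]))
    (by
      rw [Submodule.span_le]
      rintro x ⟨n, a, hn, rfl⟩
      simp [dU, h₃ n a hn])

@[simp] lemma Omega.lift_d {N : Type*} [AddCommGroup N] [Module (Unitization F A) N] (D : A → N)
    (h₁ h₂ h₃) (a : A) : Omega.lift (F := F) D h₁ h₂ h₃ (dOmega F A a) = D a := by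
  simp [Omega.lift, dOmega, dU]

lemma Omega.span_range_d :
    Submodule.span (Unitization F A) (Set.range (dOmega F A)) = ⊤ := by
  rw [eq_top_iff]
  rintro m -
  obtain ⟨m, rfl⟩ := Submodule.Quotient.mk_surjective _ m
  obtain ⟨m, rfl⟩ := Submodule.Quotient.mk_surjective _ m
  induction m using Finsupp.induction_linear with
  | zero => exact zero_mem _
  | add x y hx hy => exact add_mem hx hy
  | single a r =>
    have : (Submodule.Quotient.mk (Submodule.Quotient.mk (Finsupp.single a r)) : Omega F A) =
        r • dOmega F A a := by
      rw [dOmega, dU, ← Submodule.Quotient.mk_smul, ← Submodule.Quotient.mk_smul,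
        Finsupp.smul_single, smul_eq_mul, mul_one]
    rw [this]
    exact Submodule.smul_mem _ _ (Submodule.subset_span ⟨a, rfl⟩)

variable (F A)

/-- The divided power algebra `T°(A) = Γ⁺_A(Ω¹_A)`. -/
noncomputable abbrev TCirc : Type u := FreeDP F A (Omega F A)

/-- The inclusion `A → T°(A)`, giving the generators of type `a`. -/
noncomputable def TCirc.incl : DPHom F A (TCirc F A) := FreeDP.incl F A (Omega F A)

/-- The map `A → T°(A)` giving the generators of type `d a`. -/
noncomputable def TCirc.d (a : A) : TCirc F A :=
  (DPHom.Restrict.of (FreeDP.incl F A (Omega F A))).symm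
    (FreeDP.gen F A (Omega F A) (dOmega F A a))

variable {F A}

namespace TCirc

lemma d_add_smul (c : F) (a b : A) : d F A (a + c • b) = d F A a + c • d F A b := by
  unfold d
  rw [dOmega_add_smul, map_add, map_smul, map_add, DPHom.Restrict.smul_def]
  simp

lemma d_mul (a b : A) :
    d F A (a * b) = incl F A a * d F A b + incl F A b * d F A a := by
  unfold d
  rw [dOmega_mul, map_add, map_smul, map_smul, map_add, DPHom.Restrict.smul_def,
    DPHom.Restrict.smul_def]
  simp [incl]

lemma d_dpow (n : ℕ) (hn : 2 ≤ n) (a : A) :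
    d F A (DPAlgebra.dpow F n a) = incl F A (DPAlgebra.dpow F (n - 1) a) * d F A a := by
  unfold d
  rw [dOmega_dpow n hn, map_smul, DPHom.Restrict.smul_def]
  simp [incl]

/-- `T°(A)` is generated by the elements `a` and `d a`: morphisms out of it are determined by their
values there. -/
lemma hom_ext {B : Type u} [NonUnitalCommRing B] [Module F B]
    [IsScalarTower F B B] [SMulCommClass F B B] [DPAlgebra F B] {g h : DPHom F (TCirc F A) B}
    (h₁ : ∀ a, g (incl F A a) = h (incl F A a)) (h₂ : ∀ a, g (d F A a) = h (d F A a)) :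
    g = h := by
  refine FreeDP.hom_ext h₁ fun m => ?_
  have hm : m ∈ Submodule.span (Unitization F A) (Set.range (dOmega F A)) := by
    rw [Omega.span_range_d (F := F) (A := A)]; trivial
  induction hm using Submodule.span_induction with
  | mem _ hx => obtain ⟨a, rfl⟩ := hx; exact h₂ a
  | zero => rw [map_zero, map_zero, map_zero, map_zero]
  | add x y _ _ hx hy => rw [map_add, map_add, map_add, map_add, hx, hy]
  | smul r x _ hx =>
    rw [map_smul, DPHom.Restrict.smul_def, map_add, map_add, map_smul, map_smul, g.map_mul,
      h.map_mul, hx, show g (FreeDP.incl F A (Omega F A) r.snd) = _ from h₁ r.snd]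
    rfl

/-- The morphism `T°(A) → B` with `a ↦ f a` and `d a ↦ D a`. -/
noncomputable def lift {B : Type u} [NonUnitalCommRing B] [Module F B]
    [IsScalarTower F B B] [SMulCommClass F B B] [DPAlgebra F B] (f : DPHom F A B) (D : A → B)
    (h₁ : ∀ (c : F) (a b : A), D (a + c • b) = D a + c • D b)
    (h₂ : ∀ a b : A, D (a * b) = f a * D b + f b * D a)
    (h₃ : ∀ (n : ℕ) (a : A), 2 ≤ n →
      D (DPAlgebra.dpow F n a) = f (DPAlgebra.dpow F (n - 1) a) * D a) :
    DPHom F (TCirc F A) B :=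
  FreeDP.lift f (Omega.lift (fun a => DPHom.Restrict.of f (D a))
    (fun c a b => (DPHom.Restrict.of f).symm.injective (by
      rw [map_add, DPHom.Restrict.smul_def]; simp [h₁]))
    (fun a b => (DPHom.Restrict.of f).symm.injective (by
      rw [map_add, DPHom.Restrict.smul_def, DPHom.Restrict.smul_def]; simp [h₂]))
    (fun n a hn => (DPHom.Restrict.of f).symm.injective (by
      rw [DPHom.Restrict.smul_def]; simp [h₃ n a hn])))

section

variable {B : Type u} [NonUnitalCommRing B] [Module F B]
    [IsScalarTower F B B] [SMulCommClass F B B] [DPAlgebra F B] (f : DPHom F A B) (D : A → B)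
    (h₁ : ∀ (c : F) (a b : A), D (a + c • b) = D a + c • D b)
    (h₂ : ∀ a b : A, D (a * b) = f a * D b + f b * D a)
    (h₃ : ∀ (n : ℕ) (a : A), 2 ≤ n →
      D (DPAlgebra.dpow F n a) = f (DPAlgebra.dpow F (n - 1) a) * D a)

@[simp] lemma lift_incl (a : A) : lift f D h₁ h₂ h₃ (incl F A a) = f a := rfl

@[simp] lemma lift_d (a : A) : lift f D h₁ h₂ h₃ (d F A a) = D a := by
  unfold lift d
  rw [FreeDP.lift_gen, Omega.lift_d]
  simp

end

variable {B : Type u} [NonUnitalCommRing B] [Module F B]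
    [IsScalarTower F B B] [SMulCommClass F B B] [DPAlgebra F B]

/-- The morphism `T°(f) : T°(A) → T°(B)`, with `a ↦ f a` and `d a ↦ d (f a)`. -/
noncomputable def map (f : DPHom F A B) : DPHom F (TCirc F A) (TCirc F B) :=
  lift ((incl F B).comp f) (fun a => d F B (f a))
    (fun c a b => by rw [map_add, map_smul, d_add_smul])
    (fun a b => by rw [f.map_mul, d_mul]; rfl)
    (fun n a hn => by rw [f.map_dpow, d_dpow n hn, DPHom.comp_apply, f.map_dpow])

@[simp] lemma map_incl (f : DPHom F A B) (a : A) :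
    TCirc.map f (incl F A a) = incl F B (f a) := rfl

@[simp] lemma map_d (f : DPHom F A B) (a : A) :
    TCirc.map f (d F A a) = d F B (f a) := lift_d _ _ _ _ _ a

end TCirc

end Kaehler

/-- The geometric tangent functor `T° : A ↦ Γ⁺_A(Ω¹_A)`, as an endofunctor of the category of
divided power algebras. -/
noncomputable def geoTangent (F : Type u) [Field F] : DPAlg.{u} F ⥤ DPAlg.{u} F where
  obj A := ⟨TCirc F A⟩
  map {A B} f := TCirc.map (A := A) (B := B) f
  map_id A := TCirc.hom_ext (fun _ => TCirc.map_incl _ _)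
    (fun _ => TCirc.map_d _ _)
  map_comp {A B C} f g := TCirc.hom_ext (fun _ => rfl)
    (fun a => by
      refine (TCirc.map_d (A := A) (B := C) _ a).trans ?_
      change _ = TCirc.map (A := B) (B := C) g (TCirc.map (A := A) (B := B) f (TCirc.d F A a))
      rw [TCirc.map_d, TCirc.map_d]
      rfl)

section Generators

variable {F : Type u} [Field F] (A : DPAlg.{u} F)

/-- The generators of type `a` of `T°(A)`, as a morphism of divided power algebras. -/
noncomputable def geoIncl : A ⟶ (geoTangent F).obj A := TCirc.incl F A

/-- The generators of type `d a` of `T°(A)`. -/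
noncomputable def geoD (a : A) : (geoTangent F).obj A := TCirc.d F A a

end Generators

/-! ### Rosický tangent structures -/

section Tangent

variable {C : Type*} [Category C]

/-- The `m`-th iterate of an endofunctor. -/
def iterFunctor (T : C ⥤ C) : ℕ → (C ⥤ C)
  | 0 => 𝟭 C
  | m + 1 => iterFunctor T m ⋙ T

open Limits in
/-- A Rosický tangent structure with tangent bundle functor `T`: a projection `p` with fibre powers
`T_n` preserved by all iterates of `T`, a sum `s`, a zero `z`, a vertical lift `l`, a canonical flip
`c` and a negative `n`. Composition is written in diagrammatic order. The morphisms `w` in the axioms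
are the (unique) morphisms into a pullback with the prescribed components. -/
structure RosickyTangentStructure (T : C ⥤ C) where
  /-- projection -/
  p : T ⟶ 𝟭 C
  /-- the fibre powers `T_n` of the projection, with their map to the base and projections -/
  Tn : ℕ → (C ⥤ C)
  base : ∀ n, Tn n ⟶ 𝟭 C
  q : ∀ n, Fin n → (Tn n ⟶ T)
  q_p : ∀ n (j : Fin n) (A : C), (q n j).app A ≫ p.app A = (base n).app A
  /-- `T^m (T_n A)` is the `n`-fold pullback of `T^m (p_A)`, for all `m` and `n` -/
  isLimit : ∀ (m n : ℕ) (A : C), Nonempty (IsLimit (WidePullbackCone.mk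
    (f := fun _ : Fin n => (iterFunctor T m).map (p.app A))
    ((iterFunctor T m).map ((base n).app A))
    (fun j => (iterFunctor T m).map ((q n j).app A))
    (fun j => by rw [← Functor.map_comp, q_p])))
  /-- sum -/
  s : Tn 2 ⟶ T
  /-- zero -/
  z : 𝟭 C ⟶ T
  /-- vertical lift -/
  l : T ⟶ T ⋙ T
  /-- canonical flip -/
  c : T ⋙ T ⟶ T ⋙ T
  /-- negative -/
  n : T ⟶ T
  -- `(p, s, z)` is a commutative monoid in the slice over `A`, with inverses given by `n`
  s_p : ∀ A, s.app A ≫ p.app A = (base 2).app A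
  z_p : ∀ A, z.app A ≫ p.app A = 𝟙 A
  s_assoc : ∀ A, ∃ w₀₁ w₁₂ w w' : (Tn 3).obj A ⟶ (Tn 2).obj A,
    (w₀₁ ≫ (q 2 0).app A = (q 3 0).app A ∧ w₀₁ ≫ (q 2 1).app A = (q 3 1).app A) ∧
    (w₁₂ ≫ (q 2 0).app A = (q 3 1).app A ∧ w₁₂ ≫ (q 2 1).app A = (q 3 2).app A) ∧
    (w ≫ (q 2 0).app A = w₀₁ ≫ s.app A ∧ w ≫ (q 2 1).app A = (q 3 2).app A) ∧
    (w' ≫ (q 2 0).app A = (q 3 0).app A ∧ w' ≫ (q 2 1).app A = w₁₂ ≫ s.app A) ∧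
    w ≫ s.app A = w' ≫ s.app A
  s_comm : ∀ A, ∃ w : (Tn 2).obj A ⟶ (Tn 2).obj A,
    w ≫ (q 2 0).app A = (q 2 1).app A ∧ w ≫ (q 2 1).app A = (q 2 0).app A ∧
    w ≫ s.app A = s.app A
  s_zero : ∀ A, ∃ w : T.obj A ⟶ (Tn 2).obj A,
    w ≫ (q 2 0).app A = 𝟙 (T.obj A) ∧ w ≫ (q 2 1).app A = p.app A ≫ z.app A ∧
    w ≫ s.app A = 𝟙 (T.obj A)
  n_p : ∀ A, n.app A ≫ p.app A = p.app A
  s_neg : ∀ A, ∃ w : T.obj A ⟶ (Tn 2).obj A,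
    w ≫ (q 2 0).app A = 𝟙 (T.obj A) ∧ w ≫ (q 2 1).app A = n.app A ∧
    w ≫ s.app A = p.app A ≫ z.app A
  -- `(l, z)` is a morphism of additive bundles from `p_A` to `T (p_A)`
  l_p : ∀ A, l.app A ≫ T.map (p.app A) = p.app A ≫ z.app A
  z_l : ∀ A, z.app A ≫ l.app A = z.app A ≫ T.map (z.app A)
  s_l : ∀ A, ∃ w : (Tn 2).obj A ⟶ T.obj ((Tn 2).obj A),
    w ≫ T.map ((q 2 0).app A) = (q 2 0).app A ≫ l.app A ∧
    w ≫ T.map ((q 2 1).app A) = (q 2 1).app A ≫ l.app A ∧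
    s.app A ≫ l.app A = w ≫ T.map (s.app A)
  -- `(c, 𝟙)` is a morphism of additive bundles from `T (p_A)` to `p_{T A}`
  c_p : ∀ A, c.app A ≫ p.app (T.obj A) = T.map (p.app A)
  z_c : ∀ A, T.map (z.app A) ≫ c.app A = z.app (T.obj A)
  s_c : ∀ A, ∃ w : T.obj ((Tn 2).obj A) ⟶ (Tn 2).obj (T.obj A),
    w ≫ (q 2 0).app (T.obj A) = T.map ((q 2 0).app A) ≫ c.app A ∧
    w ≫ (q 2 1).app (T.obj A) = T.map ((q 2 1).app A) ≫ c.app A ∧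
    T.map (s.app A) ≫ c.app A = w ≫ s.app (T.obj A)
  -- coherence of `l` and `c`
  c_c : ∀ A, c.app A ≫ c.app A = 𝟙 (T.obj (T.obj A))
  l_c : ∀ A, l.app A ≫ c.app A = l.app A
  l_l : ∀ A, l.app A ≫ T.map (l.app A) = l.app A ≫ l.app (T.obj A)
  c_c_c : ∀ A, T.map (c.app A) ≫ c.app (T.obj A) ≫ T.map (c.app A) =
    c.app (T.obj A) ≫ T.map (c.app A) ≫ c.app (T.obj A)
  l_c_c : ∀ A, l.app (T.obj A) ≫ T.map (c.app A) ≫ c.app (T.obj A) = c.app A ≫ T.map (l.app A)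
  /-- universality of the vertical lift: `⟨q₀ l, q₁ z_T⟩ T(s) : T_2 A → T² A` is an equaliser of
  `T(p)` and `p_T p z` -/
  universal : ∀ A, ∃ (w : (Tn 2).obj A ⟶ T.obj ((Tn 2).obj A))
    (h : (w ≫ T.map (s.app A)) ≫ T.map (p.app A) =
      (w ≫ T.map (s.app A)) ≫ p.app (T.obj A) ≫ p.app A ≫ z.app A),
    w ≫ T.map ((q 2 0).app A) = (q 2 0).app A ≫ l.app A ∧
    w ≫ T.map ((q 2 1).app A) = (q 2 1).app A ≫ z.app (T.obj A) ∧
    Nonempty (IsLimit (Fork.ofι (w ≫ T.map (s.app A)) h))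

namespace RosickyTangentStructure

/-! For a tangent structure on the opposite of a category `C`, the structure maps read in `C`. -/

variable {G : C ⥤ C} (𝕋 : RosickyTangentStructure G.op)

/-- The opposite `A ⟶ G A` of the projection. -/
def coP (A : C) : A ⟶ G.obj A := (𝕋.p.app (op A)).unop

/-- The `n`-fold pushout of `coP`. -/
def coTn (n : ℕ) (A : C) : C := ((𝕋.Tn n).obj (op A)).unop

/-- The canonical map from the base to the `n`-fold pushout. -/
def coBase (n : ℕ) (A : C) : A ⟶ 𝕋.coTn n A := ((𝕋.base n).app (op A)).unop

/-- The coprojections of the `n`-fold pushout. -/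
def coQ (n : ℕ) (j : Fin n) (A : C) : G.obj A ⟶ 𝕋.coTn n A := ((𝕋.q n j).app (op A)).unop

/-- The opposite of the sum. -/
def coS (A : C) : G.obj A ⟶ 𝕋.coTn 2 A := (𝕋.s.app (op A)).unop

/-- The opposite of the zero. -/
def coZ (A : C) : G.obj A ⟶ A := (𝕋.z.app (op A)).unop

/-- The opposite of the vertical lift. -/
def coL (A : C) : G.obj (G.obj A) ⟶ G.obj A := (𝕋.l.app (op A)).unop

/-- The opposite of the canonical flip. -/
def coC (A : C) : G.obj (G.obj A) ⟶ G.obj (G.obj A) := (𝕋.c.app (op A)).unop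

/-- The opposite of the negative. -/
def coN (A : C) : G.obj A ⟶ G.obj A := (𝕋.n.app (op A)).unop

end RosickyTangentStructure

end Tangent

/-! ### Adjointness with the algebraic tangent structure -/

namespace Semidirect

variable {A : Type v} [NonUnitalCommRing A]

/-- Projection of the algebraic tangent structure: `(a, b) ↦ a`. -/
def algP (x : Semidirect A) : A := x.1

/-- Sum of the algebraic tangent structure: `(a, b), (a, b') ↦ (a, b + b')`. -/
def algS (x y : Semidirect A) : Semidirect A := (x.1, x.2 + y.2)

/-- Zero of the algebraic tangent structure: `a ↦ (a, 0)`. -/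
def algZ (a : A) : Semidirect A := (a, 0)

/-- Vertical lift of the algebraic tangent structure: `(a, b) ↦ ((a, 0), (0, b))`. -/
def algL (x : Semidirect A) : Semidirect (Semidirect A) := ((x.1, 0), (0, x.2))

/-- Canonical flip of the algebraic tangent structure: `((a, b), (c, d)) ↦ ((a, c), (b, d))`. -/
def algC (x : Semidirect (Semidirect A)) : Semidirect (Semidirect A) :=
  ((x.1.1, x.2.1), (x.1.2, x.2.2))

/-- Negative of the algebraic tangent structure: `(a, b) ↦ (a, -b)`. -/
def algN (x : Semidirect A) : Semidirect A := (x.1, -x.2)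

end Semidirect

/-- A tangent structure `𝕋` on the opposite category of divided power algebras, with tangent bundle
functor `T°`, is adjoint (via `adj : T° ⊣ T`) to the algebraic tangent structure on `T : A ↦ A ⋉ A`
when the structure maps of `𝕋` are the mates of the algebraic ones: precomposition with a structure
map of `𝕋` corresponds, after transposition, to postcomposition with the algebraic one. -/
structure IsAdjointTangentStructure {F : Type u} [Field F]
    (𝕋 : RosickyTangentStructure (geoTangent.{u} F).op) (adj : geoTangent F ⊣ algTangent F) :
    Prop where
  p : ∀ (A B : DPAlg.{u} F) (f : (geoTangent F).obj A ⟶ B) (a : A),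
    (𝕋.coP A ≫ f) a = Semidirect.algP (adj.homEquiv A B f a)
  s : ∀ (A B : DPAlg.{u} F) (f : 𝕋.coTn 2 A ⟶ B) (a : A),
    adj.homEquiv A B (𝕋.coS A ≫ f) a =
      Semidirect.algS (adj.homEquiv A B (𝕋.coQ 2 0 A ≫ f) a)
        (adj.homEquiv A B (𝕋.coQ 2 1 A ≫ f) a)
  z : ∀ (A B : DPAlg.{u} F) (f : A ⟶ B) (a : A),
    adj.homEquiv A B (𝕋.coZ A ≫ f) a = Semidirect.algZ (f a)
  l : ∀ (A B : DPAlg.{u} F) (f : (geoTangent F).obj A ⟶ B) (a : A),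
    adj.homEquiv A _ (adj.homEquiv _ B (𝕋.coL A ≫ f)) a =
      Semidirect.algL (adj.homEquiv A B f a)
  c : ∀ (A B : DPAlg.{u} F) (f : (geoTangent F).obj ((geoTangent F).obj A) ⟶ B) (a : A),
    adj.homEquiv A _ (adj.homEquiv _ B (𝕋.coC A ≫ f)) a =
      Semidirect.algC (adj.homEquiv A _ (adj.homEquiv _ B f) a)
  n : ∀ (A B : DPAlg.{u} F) (f : (geoTangent F).obj A ⟶ B) (a : A),
    adj.homEquiv A B (𝕋.coN A ≫ f) a = Semidirect.algN (adj.homEquiv A B f a)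

/-!
A morphism of divided power algebras `A → B ⋉ B` is a pair `(f, D)` of a morphism `f : A → B` and an
`F`-linear map `D : A → B` with `D (a * b) = f a * D b + f b * D a` and
`D (a^{[n]}) = f (a^{[n-1]}) * D a` for `n ≥ 2`. These are the relations that hold in `Ω¹_A`, so that
`T°(A) = Γ⁺_A(Ω¹_A)` represents `B ↦ Hom(A, B ⋉ B)`. This is the adjunction `T° ⊣ T`
(`DPAlg.geoAdj`), and every map out of `T°(A)` below is the transpose of an explicit map into a
semidirect product: the zero, the lift, the flip and the negative of the algebraic side are
morphisms of divided power algebras (`DPAlg.algZero`, `DPAlg.algLift`, `DPAlg.algFlip`,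
`DPAlg.algNeg`), as is the fibrewise sum (`DPAlg.algAdd`), and their mates are the structure maps of
the geometric side.

Although `d` is not a morphism, a morphism out of an iterate of `T°` is determined by its values on
the generators coming from `A`, because its transposes are morphisms (`DPAlg.geo_hom_ext₂`,
`DPAlg.geo_hom_ext₃`). The equational axioms are thereby checked on generators.

The `n`-fold pushout of `A → T°(A)` is `Γ⁺_A((Ω¹_A)ⁿ)` (`DPAlg.geoPow`), since `Γ⁺_A` turns finite
direct sums of modules into pushouts under `A` (`FreeDP.powDesc`, `FreeDP.pow_hom_ext`). It is
preserved by all iterates of `T°`, which are left adjoints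
(`nonempty_isLimit_iterFunctor_widePullbackCone`).

Universality of the vertical lift says that a morphism `k` out of `T°T°A` that kills all `d' a`
factors uniquely through `T°₂(A)`. The transpose of `k` is a morphism `a ↦ ((f a, 0), (D a, D' a))`
into `B ⋉ B ⋉ B`. The elements `(x, 0)` act componentwise on `B ⋉ B`, so that `(f, D)` and `(f, D')`
are both morphisms into `B ⋉ B` (`DPAlg.algDiag`), and together they define the morphism out of
`T°₂(A)`.

The axioms are proved with all arrows reversed, as a `CotangentStructure` on an arbitrary category,
and then transported to the opposite category (`CotangentStructure.toRosicky`).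
-/

/-! ### Morphisms into the semidirect product -/

namespace Semidirect

open DPAlgebra

variable {F : Type u} [Field F] {A : Type v} {B : Type w}
  [NonUnitalCommRing A] [Module F A] [DPAlgebra F A]
  [NonUnitalCommRing B] [Module F B] [IsScalarTower F B B] [SMulCommClass F B B] [DPAlgebra F B]

lemma fst_dpow (n : ℕ) (x : Semidirect B) : (dpow F n x).1 = dpow F n x.1 := fst_dp n x

lemma snd_dpow_succ (n : ℕ) (x : Semidirect B) :
    (dpow F (n + 1) x).2 = dpowAct F n x.1 x.2 := rfl

/-- A map `a ↦ (f a, D a)` into `B ⋉ B` whose first component is a morphism is a morphism as soon as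
`D` is linear and satisfies the Leibniz and divided power rules. -/
def homMk (f : DPHom F A B) (D : A →ₗ[F] B)
    (h₂ : ∀ a b, D (a * b) = f a * D b + f b * D a)
    (h₃ : ∀ n a, D (dpow F (n + 1) a) = dpowAct F n (f a) (D a)) :
    DPHom F A (Semidirect B) where
  toFun a := (f a, D a)
  map_add' a b := Semidirect.ext (map_add f a b) (map_add D a b)
  map_smul' c a := Semidirect.ext (map_smul f c a) (map_smul D c a)
  map_mul' a b := Semidirect.ext (f.map_mul a b) (h₂ a b)
  map_dpow' n a hn := by
    obtain ⟨n, rfl⟩ := Nat.exists_eq_succ_of_ne_zero hn.ne'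
    exact Semidirect.ext (f.map_dpow _ a) (h₃ n a)

variable (F B) in
/-- The projection `(a, b) ↦ a` as a morphism. -/
def fstHom : DPHom F (Semidirect B) B where
  toFun x := x.1
  map_add' _ _ := rfl
  map_smul' _ _ := rfl
  map_mul' _ _ := rfl
  map_dpow' n x _ := fst_dpow n x

lemma snd_map_mul (h : DPHom F A (Semidirect B)) (a b : A) :
    (h (a * b)).2 = (h a).1 * (h b).2 + (h b).1 * (h a).2 := by
  rw [h.map_mul, snd_mul]

lemma snd_map_dpow (h : DPHom F A (Semidirect B)) (n : ℕ) (a : A) :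
    (h (dpow F (n + 1) a)).2 = dpowAct F n (h a).1 (h a).2 := by
  rw [h.map_dpow, snd_dpow_succ]

/-- The second component of a morphism into `B ⋉ B`, as a linear map. -/
def sndₗ (h : DPHom F A (Semidirect B)) : A →ₗ[F] B where
  toFun a := (h a).2
  map_add' a b := by rw [map_add, snd_add]
  map_smul' c a := by rw [map_smul, snd_smul]; rfl

variable (F B) in
/-- The zero `b ↦ (b, 0)` as a morphism. -/
def zeroHom : DPHom F B (Semidirect B) :=
  homMk (DPHom.id F B) 0 (fun _ _ => by simp) (fun n a => by
    simpa using (dpowAct_smul n (0 : F) a 0).symm)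

/-- The morphism `a ↦ (f a, D a + D' a)` obtained from `a ↦ (f a, D a)` and `a ↦ (f a, D' a)`. -/
def addHom (h k : DPHom F A (Semidirect B)) (hk : ∀ a, (h a).1 = (k a).1) :
    DPHom F A (Semidirect B) :=
  homMk ((fstHom F B).comp h) (sndₗ h + sndₗ k)
    (fun a b => by
      change (h (a * b)).2 + (k (a * b)).2 =
        (h a).1 * ((h b).2 + (k b).2) + (h b).1 * ((h a).2 + (k a).2)
      rw [snd_map_mul, snd_map_mul, ← hk, ← hk, mul_add, mul_add]
      abel)
    (fun n a => by
      change (h (dpow F (n + 1) a)).2 + (k (dpow F (n + 1) a)).2 =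
        dpowAct F n (h a).1 ((h a).2 + (k a).2)
      rw [snd_map_dpow, snd_map_dpow, ← hk, dpowAct_add])

variable (F B) in
/-- The negative `(a, b) ↦ (a, -b)` as a morphism. -/
def negHom : DPHom F (Semidirect B) (Semidirect B) :=
  homMk (fstHom F B) (-sndₗ (DPHom.id F _))
    (fun x y => by
      change -(x.1 * y.2 + y.1 * x.2) = x.1 * -y.2 + y.1 * -x.2
      rw [mul_neg, mul_neg, neg_add])
    (fun n x => by
      change -dpowAct F n x.1 x.2 = dpowAct F n x.1 (-x.2)
      rw [← neg_one_smul F x.2, dpowAct_smul, neg_one_smul])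

lemma fst_dpowAct (n : ℕ) (x y : Semidirect B) :
    (dpowAct F n x y).1 = dpowAct F n x.1 y.1 := by
  unfold dpowAct
  split_ifs
  · rfl
  · rw [fst_mul, fst_dpow]

/-- The divided powers of an element `x` with vanishing second component act on `B ⋉ B`
componentwise. -/
lemma snd_dpowAct_of_snd_eq_zero (n : ℕ) {x : Semidirect B} (hx : x.2 = 0) (y : Semidirect B) :
    (dpowAct F n x y).2 = dpowAct F n x.1 y.2 := by
  rcases n with _ | n
  · simp
  · rw [dpowAct_of_pos n.succ_pos, dpowAct_of_pos n.succ_pos, snd_mul, fst_dpow, snd_dpow_succ, hx]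
    have h0 : dpowAct F n x.1 (0 : B) = 0 := by
      simpa using dpowAct_smul n (0 : F) x.1 (0 : B)
    rw [h0, mul_zero, add_zero]

variable (F B) in
/-- The vertical lift `(a, b) ↦ ((a, 0), (0, b))` as a morphism. -/
def liftHom : DPHom F (Semidirect B) (Semidirect (Semidirect B)) :=
  homMk ((zeroHom F B).comp (fstHom F B))
    { toFun := fun x => (0, x.2)
      map_add' := fun x y => Semidirect.ext (add_zero 0).symm rfl
      map_smul' := fun c x => Semidirect.ext (smul_zero c).symm rfl }
    (fun x y => Semidirect.ext
      (by change (0 : B) = x.1 * 0 + y.1 * 0; simp)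
      (by change x.1 * y.2 + y.1 * x.2 = (x.1 * y.2 + 0 * 0) + (y.1 * x.2 + 0 * 0); simp))
    (fun n x => by
      refine Semidirect.ext ?_ ?_
      · rw [fst_dpowAct]
        change (0 : B) = dpowAct F n x.1 0
        simpa using (dpowAct_smul n (0 : F) x.1 (0 : B)).symm
      · exact (snd_dpowAct_of_snd_eq_zero (F := F) n (x := zeroHom F B x.1) rfl (0, x.2)).symm)

lemma snd_dpowAct_succ (n : ℕ) (x y : Semidirect B) :
    (dpowAct F (n + 1) x y).2 = dpow F (n + 1) x.1 * y.2 + y.1 * dpowAct F n x.1 x.2 := by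
  rw [dpowAct_of_pos n.succ_pos, snd_mul, fst_dpow, snd_dpow_succ]

/-- The second component of `(a, b)^{[n]} * (c, d)` is `a^{[n]} * d + a^{[n-1]} * b * c`, which is
symmetric in `b` and `c`. -/
lemma snd_dpowAct_flip (n : ℕ) {x y x' y' : Semidirect B} (h₁ : x.1 = x'.1) (h₂ : x.2 = y'.1)
    (h₃ : y.1 = x'.2) (h₄ : y.2 = y'.2) : (dpowAct F n x y).2 = (dpowAct F n x' y').2 := by
  rcases n with _ | n
  · simp [h₄]
  · rw [snd_dpowAct_succ, snd_dpowAct_succ, h₁, h₂, h₃, h₄, mul_comm x'.2, mul_comm y'.1,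
      ← dpowAct_mul, ← dpowAct_mul, mul_comm x'.2]

variable (F B) in
/-- The canonical flip `((a, b), (c, d)) ↦ ((a, c), (b, d))` as a morphism. -/
def flipHom : DPHom F (Semidirect (Semidirect B)) (Semidirect (Semidirect B)) :=
  homMk (Semidirect.map (fstHom F B))
    { toFun := fun x => (x.1.2, x.2.2)
      map_add' := fun _ _ => rfl
      map_smul' := fun _ _ => rfl }
    (fun x y => Semidirect.ext rfl (by
      change (x.1.1 * y.2.2 + y.2.1 * x.1.2) + (y.1.1 * x.2.2 + x.2.1 * y.1.2) =
        (x.1.1 * y.2.2 + y.1.2 * x.2.1) + (y.1.1 * x.2.2 + x.1.2 * y.2.1)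
      rw [mul_comm y.1.2, mul_comm x.1.2]
      abel))
    (fun n x => by
      refine Semidirect.ext ?_ ?_
      · rw [fst_dpowAct]
        rfl
      · exact snd_dpowAct_flip n rfl rfl rfl rfl)

/-- A morphism `a ↦ ((f a, 0), (D a, D' a))` into `B ⋉ B ⋉ B` yields the morphism
`a ↦ (f a, D' a)`. -/
def diagHom (h : DPHom F A (Semidirect (Semidirect B))) (hh : ∀ a, (h a).1.2 = 0) :
    DPHom F A (Semidirect B) :=
  homMk ((fstHom F B).comp ((fstHom F _).comp h)) 
    { toFun := fun a => (h a).2.2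
      map_add' := fun a b => by rw [map_add, snd_add, snd_add]
      map_smul' := fun c a => by rw [map_smul, snd_smul, snd_smul]; rfl }
    (fun a b => by
      change (h (a * b)).2.2 = (h a).1.1 * (h b).2.2 + (h b).1.1 * (h a).2.2
      rw [snd_map_mul, snd_add, snd_mul, snd_mul, hh, hh, mul_zero, mul_zero, add_zero, add_zero])
    (fun n a => by
      change (h (dpow F (n + 1) a)).2.2 = dpowAct F n (h a).1.1 (h a).2.2
      rw [snd_map_dpow, snd_dpowAct_of_snd_eq_zero n (hh a)])

end Semidirect

/-! ### Transposition of morphisms out of `T°(A)` -/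

namespace TCirc

open Semidirect DPAlgebra

variable {F : Type u} [Field F] {A B : Type u}
  [NonUnitalCommRing A] [Module F A] [IsScalarTower F A A] [SMulCommClass F A A] [DPAlgebra F A]
  [NonUnitalCommRing B] [Module F B] [IsScalarTower F B B] [SMulCommClass F B B] [DPAlgebra F B]

variable (F A) in
/-- The unit `a ↦ (a, d a)` of the adjunction between `T°` and `B ↦ B ⋉ B`. -/
noncomputable def unit : DPHom F A (Semidirect (TCirc F A)) :=
  homMk (incl F A)
    { toFun := d F A
      map_add' := fun a b => by simpa using d_add_smul (1 : F) a b
      map_smul' := fun c a => by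
        have h := d_add_smul (1 : F) (0 : A) 0
        have h' := d_add_smul c (0 : A) a
        simp only [smul_zero, add_zero, one_smul, left_eq_add] at h
        simpa [h] using h' }
    d_mul
    (fun n a => by
      rcases n with _ | n
      · simp [dpow_one]
      · change d F A (dpow F (n + 1 + 1) a) = dpowAct F (n + 1) (incl F A a) (d F A a)
        rw [d_dpow _ (by omega), dpowAct_of_pos n.succ_pos, Nat.add_sub_cancel, DPHom.map_dpow])

/-- The morphism `T°(A) → B` with `a ↦ (h a).1` and `d a ↦ (h a).2`, the transpose of `h`. -/
noncomputable def desc (h : DPHom F A (Semidirect B)) : DPHom F (TCirc F A) B :=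
  lift ((fstHom F B).comp h) (fun a => (h a).2)
    (fun c a b => by rw [map_add, map_smul, snd_add, snd_smul])
    (snd_map_mul h)
    (fun n a hn => by
      obtain ⟨n, rfl⟩ := Nat.exists_eq_add_of_le' hn
      rw [snd_map_dpow, dpowAct_of_pos n.succ_pos, DPHom.map_dpow]
      rfl)

lemma desc_d (h : DPHom F A (Semidirect B)) (a : A) : desc h (d F A a) = (h a).2 :=
  lift_d _ _ _ _ _ a

end TCirc

/-! ### Pushouts of free divided power algebras -/

namespace FreeDP

variable {F : Type u} [Field F] {A : Type u}
  [NonUnitalCommRing A] [Module F A] [IsScalarTower F A A] [SMulCommClass F A A] [DPAlgebra F A]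
  {M : Type u} [AddCommGroup M] [Module (Unitization F A) M] {ι : Type} [Fintype ι] [DecidableEq ι]
  {B : Type u} [NonUnitalCommRing B] [Module F B] [IsScalarTower F B B] [SMulCommClass F B B]
  [DPAlgebra F B]

variable (F A M) in
/-- The `j`-th coprojection `Γ⁺_A(M) → Γ⁺_A(Mⁿ)`. -/
def coproj (j : ι) : DPHom F (FreeDP F A M) (FreeDP F A (ι → M)) :=
  lift (incl F A (ι → M)) (gen F A (ι → M) ∘ₗ LinearMap.single _ (fun _ => M) j)

/-- The `U(A)`-linear map `M → B` underlying a morphism `Γ⁺_A(M) → B` under `A`. -/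
def toLinear (f : DPHom F A B) (k : DPHom F (FreeDP F A M) B)
    (hk : ∀ a, k (incl F A M a) = f a) : M →ₗ[Unitization F A] f.Restrict where
  toFun m := DPHom.Restrict.of f (k ((DPHom.Restrict.of _).symm (gen F A M m)))
  map_add' m m' := by simp only [map_add]
  map_smul' r m := (DPHom.Restrict.of f).symm.injective (by
    rw [RingHom.id_apply, DPHom.Restrict.smul_def, map_smul, DPHom.Restrict.smul_def, map_add k,
      map_smul k, k.map_mul, hk]
    rfl)

/-- The morphism `Γ⁺_A(Mⁿ) → B` given by a family of morphisms `Γ⁺_A(M) → B` that agree on `A`: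
`Γ⁺_A`, being a left adjoint, turns the `n`-th copower `Mⁿ` of modules into the pushout of `n`
copies of `Γ⁺_A(M)` under `A`. -/
def powDesc (f : DPHom F A B) (k : ι → DPHom F (FreeDP F A M) B)
    (hk : ∀ j a, k j (incl F A M a) = f a) : DPHom F (FreeDP F A (ι → M)) B :=
  lift f (∑ j, toLinear f (k j) (hk j) ∘ₗ LinearMap.proj j)

lemma powDesc_coproj (f : DPHom F A B) (k : ι → DPHom F (FreeDP F A M) B)
    (hk : ∀ j a, k j (incl F A M a) = f a) (j : ι) :
    (powDesc f k hk).comp (coproj F A M j) = k j := by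
  refine hom_ext (fun a => (hk j a).symm) fun m => ?_
  change (DPHom.Restrict.of f).symm ((∑ i, toLinear f (k i) (hk i) ∘ₗ LinearMap.proj i)
    (Pi.single j m)) = _
  rw [LinearMap.sum_apply, Finset.sum_eq_single j]
  · simp [toLinear]
  · intro i _ hi
    simp [Pi.single_eq_of_ne hi]
  · simp

lemma pow_hom_ext {g h : DPHom F (FreeDP F A (ι → M)) B}
    (h₁ : ∀ a, g (incl F A _ a) = h (incl F A _ a))
    (h₂ : ∀ j, g.comp (coproj F A M j) = h.comp (coproj F A M j)) : g = h := by
  refine hom_ext h₁ fun m => ?_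
  have hj (k : DPHom F (FreeDP F A (ι → M)) B) (j : ι) :
      k ((DPHom.Restrict.of _).symm (gen F A _ (Pi.single j (m j)))) =
        k.comp (coproj F A M j) ((DPHom.Restrict.of _).symm (gen F A M (m j))) := rfl
  rw [← Finset.univ_sum_single m, map_sum, map_sum, map_sum, map_sum]
  exact Finset.sum_congr rfl fun j _ => by rw [hj, hj, h₂]

end FreeDP

namespace DPAlg

variable {F : Type u} [Field F] {A B C : DPAlg.{u} F}

lemma hom_ext {f g : A ⟶ B} (h : ∀ a, f a = g a) : f = g := DPHom.ext h

lemma comp_apply (f : A ⟶ B) (g : B ⟶ C) (a : A) : (f ≫ g) a = g (f a) := rfl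

lemma id_apply (a : A) : (𝟙 A : A ⟶ A) a = a := rfl

/-! ### The algebraic tangent functor -/

/-- The first component of an element of `B ⋉ B`. -/
def fst (x : (algTangent F).obj B) : B := Semidirect.algP (A := B) x

/-- The second component of an element of `B ⋉ B`. -/
def snd (x : (algTangent F).obj B) : B := Prod.snd (α := B) (β := B) x

lemma algTangent_ext {x y : (algTangent F).obj B} (h₁ : fst x = fst y) (h₂ : snd x = snd y) :
    x = y :=
  Semidirect.ext h₁ h₂

variable (B) in
/-- The zero `b ↦ (b, 0)`. -/
def algZero : B ⟶ (algTangent F).obj B := Semidirect.zeroHom F B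

lemma snd_algZero (b : B) : snd (algZero B b) = 0 := rfl

/-- The fibrewise sum `a ↦ (f a, D a + D' a)` of `a ↦ (f a, D a)` and `a ↦ (f a, D' a)`. -/
def algAdd (h k : A ⟶ (algTangent F).obj B) (hk : ∀ a, fst (h a) = fst (k a)) :
    A ⟶ (algTangent F).obj B :=
  Semidirect.addHom (A := A) (B := B) h k hk

lemma snd_algAdd (h k : A ⟶ (algTangent F).obj B) (hk) (a : A) :
    snd (algAdd h k hk a) = snd (h a) + snd (k a) := rfl

variable (B) in
/-- The negative `(a, b) ↦ (a, -b)`. -/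
def algNeg : (algTangent F).obj B ⟶ (algTangent F).obj B := Semidirect.negHom F B

lemma snd_algNeg (x : (algTangent F).obj B) : snd (algNeg B x) = -snd x := rfl

variable (B) in
/-- The vertical lift `(a, b) ↦ ((a, 0), (0, b))`. -/
def algLift : (algTangent F).obj B ⟶ (algTangent F).obj ((algTangent F).obj B) :=
  Semidirect.liftHom F B

lemma fst_fst_algLift (x : (algTangent F).obj B) : fst (fst (algLift B x)) = fst x := rfl
lemma snd_fst_algLift (x : (algTangent F).obj B) : snd (fst (algLift B x)) = 0 := rfl
lemma fst_snd_algLift (x : (algTangent F).obj B) : fst (snd (algLift B x)) = 0 := rfl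
lemma snd_snd_algLift (x : (algTangent F).obj B) : snd (snd (algLift B x)) = snd x := rfl

variable (B) in
/-- The canonical flip `((a, b), (c, d)) ↦ ((a, c), (b, d))`. -/
def algFlip :
    (algTangent F).obj ((algTangent F).obj B) ⟶ (algTangent F).obj ((algTangent F).obj B) :=
  Semidirect.flipHom F B

section
variable (x : (algTangent F).obj ((algTangent F).obj B))

lemma fst_fst_algFlip : fst (fst (algFlip B x)) = fst (fst x) := rfl
lemma snd_fst_algFlip : snd (fst (algFlip B x)) = fst (snd x) := rfl
lemma fst_snd_algFlip : fst (snd (algFlip B x)) = snd (fst x) := rfl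
lemma snd_snd_algFlip : snd (snd (algFlip B x)) = snd (snd x) := rfl

end

/-- A morphism `a ↦ ((f a, 0), (D a, D' a))` into `B ⋉ B ⋉ B` yields the morphism
`a ↦ (f a, D' a)`. -/
def algDiag (h : A ⟶ (algTangent F).obj ((algTangent F).obj B))
    (hh : ∀ a, snd (fst (h a)) = 0) : A ⟶ (algTangent F).obj B :=
  Semidirect.diagHom (A := A) (B := B) h hh

section
variable (h : A ⟶ (algTangent F).obj ((algTangent F).obj B)) (hh : ∀ a, snd (fst (h a)) = 0)

lemma fst_algDiag (a : A) : fst (algDiag h hh a) = fst (fst (h a)) := rfl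
lemma snd_algDiag (a : A) : snd (algDiag h hh a) = snd (snd (h a)) := rfl

end

/-! ### The adjunction between the geometric and the algebraic tangent functor -/

lemma map_geoIncl (f : A ⟶ B) (a : A) :
    (geoTangent F).map f (geoIncl A a) = geoIncl B (f a) := rfl

lemma map_geoD (f : A ⟶ B) (a : A) : (geoTangent F).map f (geoD A a) = geoD B (f a) :=
  TCirc.map_d (A := A) (B := B) f a

variable (A) in
/-- The unit `a ↦ (a, d a)`. -/
noncomputable def geoUnit : A ⟶ (algTangent F).obj ((geoTangent F).obj A) := TCirc.unit F A

lemma fst_geoUnit (a : A) : fst (geoUnit A a) = geoIncl A a := rfl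
lemma snd_geoUnit (a : A) : snd (geoUnit A a) = geoD A a := rfl

/-- The transpose `a ↦ (g a, g (d a))` of a morphism `g : T°(A) → B`. -/
noncomputable def transpose (g : (geoTangent F).obj A ⟶ B) : A ⟶ (algTangent F).obj B :=
  geoUnit A ≫ (algTangent F).map g

lemma fst_transpose (g : (geoTangent F).obj A ⟶ B) (a : A) :
    fst (transpose g a) = g (geoIncl A a) := rfl

lemma snd_transpose (g : (geoTangent F).obj A ⟶ B) (a : A) :
    snd (transpose g a) = g (geoD A a) := rfl

/-- The morphism `T°(A) → B` with `a ↦ fst (h a)` and `d a ↦ snd (h a)`. -/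
noncomputable def geoDesc (h : A ⟶ (algTangent F).obj B) : (geoTangent F).obj A ⟶ B :=
  TCirc.desc (A := A) (B := B) h

lemma geoDesc_incl (h : A ⟶ (algTangent F).obj B) (a : A) :
    geoDesc h (geoIncl A a) = fst (h a) := rfl

lemma geoDesc_d (h : A ⟶ (algTangent F).obj B) (a : A) :
    geoDesc h (geoD A a) = snd (h a) :=
  TCirc.desc_d (A := A) (B := B) h a

lemma geo_hom_ext {g h : (geoTangent F).obj A ⟶ B} (h₁ : ∀ a, g (geoIncl A a) = h (geoIncl A a))
    (h₂ : ∀ a, g (geoD A a) = h (geoD A a)) : g = h :=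
  TCirc.hom_ext (A := A) (B := B) h₁ h₂

lemma transpose_injective :
    Function.Injective (transpose : ((geoTangent F).obj A ⟶ B) → (A ⟶ (algTangent F).obj B)) :=
  fun g h H => geo_hom_ext
    (fun a => by rw [← fst_transpose, H, fst_transpose])
    (fun a => by rw [← snd_transpose, H, snd_transpose])

/-- Although `d` is not a morphism, a morphism out of `T°T°A` is determined on the generators coming
from `A`: its transpose is a morphism out of `T°A`. -/
lemma geo_hom_ext₂ {g h : (geoTangent F).obj ((geoTangent F).obj A) ⟶ B}
    (h₁ : ∀ a, g (geoIncl _ (geoIncl A a)) = h (geoIncl _ (geoIncl A a)))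
    (h₂ : ∀ a, g (geoIncl _ (geoD A a)) = h (geoIncl _ (geoD A a)))
    (h₃ : ∀ a, g (geoD _ (geoIncl A a)) = h (geoD _ (geoIncl A a)))
    (h₄ : ∀ a, g (geoD _ (geoD A a)) = h (geoD _ (geoD A a))) : g = h :=
  transpose_injective (geo_hom_ext
    (fun a => algTangent_ext (by simp only [fst_transpose, h₁]) (by simp only [snd_transpose, h₃]))
    (fun a => algTangent_ext (by simp only [fst_transpose, h₂]) (by simp only [snd_transpose, h₄])))

lemma geo_hom_ext₃ {g h : (geoTangent F).obj ((geoTangent F).obj ((geoTangent F).obj A)) ⟶ B}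
    (h₁ : ∀ a, g (geoIncl _ (geoIncl _ (geoIncl A a))) = h (geoIncl _ (geoIncl _ (geoIncl A a))))
    (h₂ : ∀ a, g (geoIncl _ (geoIncl _ (geoD A a))) = h (geoIncl _ (geoIncl _ (geoD A a))))
    (h₃ : ∀ a, g (geoIncl _ (geoD _ (geoIncl A a))) = h (geoIncl _ (geoD _ (geoIncl A a))))
    (h₄ : ∀ a, g (geoIncl _ (geoD _ (geoD A a))) = h (geoIncl _ (geoD _ (geoD A a))))
    (h₅ : ∀ a, g (geoD _ (geoIncl _ (geoIncl A a))) = h (geoD _ (geoIncl _ (geoIncl A a))))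
    (h₆ : ∀ a, g (geoD _ (geoIncl _ (geoD A a))) = h (geoD _ (geoIncl _ (geoD A a))))
    (h₇ : ∀ a, g (geoD _ (geoD _ (geoIncl A a))) = h (geoD _ (geoD _ (geoIncl A a))))
    (h₈ : ∀ a, g (geoD _ (geoD _ (geoD A a))) = h (geoD _ (geoD _ (geoD A a)))) : g = h :=
  transpose_injective (geo_hom_ext₂
    (fun a => algTangent_ext (by simp only [fst_transpose, h₁]) (by simp only [snd_transpose, h₅]))
    (fun a => algTangent_ext (by simp only [fst_transpose, h₂]) (by simp only [snd_transpose, h₆]))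
    (fun a => algTangent_ext (by simp only [fst_transpose, h₃]) (by simp only [snd_transpose, h₇]))
    (fun a => algTangent_ext (by simp only [fst_transpose, h₄]) (by simp only [snd_transpose, h₈])))

lemma geoD_add (a b : A) : geoD A (a + b) = geoD A a + geoD A b :=
  map_add (Semidirect.sndₗ (TCirc.unit F A)) a b

variable (A) in
lemma geoD_zero : geoD A 0 = 0 := map_zero (Semidirect.sndₗ (TCirc.unit F A))

variable (F) in
/-- The adjunction between `T°` and `B ↦ B ⋉ B`. -/
noncomputable def geoAdj : geoTangent.{u} F ⊣ algTangent F :=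
  Adjunction.mkOfHomEquiv
    { homEquiv := fun A B =>
        { toFun := transpose
          invFun := geoDesc
          left_inv := fun g => geo_hom_ext
            (fun a => by rw [geoDesc_incl, fst_transpose])
            (fun a => by rw [geoDesc_d, snd_transpose])
          right_inv := fun h => hom_ext fun a => algTangent_ext
            (by rw [fst_transpose, geoDesc_incl])
            (by rw [snd_transpose, geoDesc_d]) }
      homEquiv_naturality_left_symm := fun f g => geo_hom_ext
        (fun a => rfl)
        (fun a => by
          change geoDesc (f ≫ g) (geoD _ a) = geoDesc g ((geoTangent F).map f (geoD _ a))
          rw [map_geoD, geoDesc_d, geoDesc_d, comp_apply])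
      homEquiv_naturality_right := fun f g => rfl }

lemma homEquiv_geoAdj (f : (geoTangent F).obj A ⟶ B) :
    (geoAdj F).homEquiv A B f = transpose f := by
  simp [geoAdj, Adjunction.mkOfHomEquiv_homEquiv]

lemma unit_geoAdj : (geoAdj F).unit.app A = geoUnit A := by
  rw [← Adjunction.homEquiv_id, homEquiv_geoAdj]
  rfl

/-! ### The pushouts of the coprojection -/

/-- The algebra `T°ₙ(A) = Γ⁺_A((Ω¹_A)ⁿ)`, a model of the `n`-fold pushout of `A → T°(A)`. -/
noncomputable def geoPow (n : ℕ) (A : DPAlg.{u} F) : DPAlg.{u} F :=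
  ⟨FreeDP F A (Fin n → Omega F A)⟩

variable {n : ℕ}

variable (A n) in
/-- The canonical morphism `A → T°ₙ(A)`. -/
noncomputable def base : A ⟶ geoPow n A := FreeDP.incl F A _

variable (A) in
/-- The `j`-th coprojection `T°(A) → T°ₙ(A)`. -/
noncomputable def coproj (j : Fin n) : (geoTangent F).obj A ⟶ geoPow n A :=
  FreeDP.coproj F A (Omega F A) j

lemma coproj_incl (j : Fin n) (a : A) : coproj A j (geoIncl A a) = base A n a := rfl

/-- The morphism out of `T°ₙ(A)` given by a family of morphisms out of `T°(A)` that agree on `A`. -/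
noncomputable def powDesc (f : A ⟶ B) (k : Fin n → ((geoTangent F).obj A ⟶ B))
    (hk : ∀ j a, k j (geoIncl A a) = f a) : geoPow n A ⟶ B :=
  FreeDP.powDesc (A := A) (B := B) f k hk

section

variable (f : A ⟶ B) (k : Fin n → ((geoTangent F).obj A ⟶ B))
  (hk : ∀ j a, k j (geoIncl A a) = f a)

lemma coproj_powDesc (j : Fin n) : coproj A j ≫ powDesc f k hk = k j :=
  FreeDP.powDesc_coproj (A := A) (B := B) f k hk j

lemma powDesc_coproj (j : Fin n) (x : (geoTangent F).obj A) :
    powDesc f k hk (coproj A j x) = k j x := by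
  rw [← comp_apply, coproj_powDesc]

end

lemma pow_hom_ext {g h : geoPow n A ⟶ B} (h₁ : ∀ a, g (base A n a) = h (base A n a))
    (h₂ : ∀ j, coproj A j ≫ g = coproj A j ≫ h) : g = h :=
  FreeDP.pow_hom_ext (A := A) (B := B) h₁ h₂

lemma pow_hom_ext_d {g h : geoPow n A ⟶ B} (h₁ : ∀ a, g (base A n a) = h (base A n a))
    (h₂ : ∀ j a, g (coproj A j (geoD A a)) = h (coproj A j (geoD A a))) : g = h :=
  pow_hom_ext h₁ fun j => geo_hom_ext h₁ (h₂ j)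

variable (n) in
/-- The morphism `T°ₙ(f)`. -/
noncomputable def powMap (f : A ⟶ B) : geoPow n A ⟶ geoPow n B :=
  powDesc (f ≫ base B n) (fun j => (geoTangent F).map f ≫ coproj B j)
    (fun j a => by rw [comp_apply, map_geoIncl, coproj_incl, comp_apply])

lemma powMap_base (f : A ⟶ B) (a : A) : powMap n f (base A n a) = base B n (f a) := rfl

lemma powMap_coproj (f : A ⟶ B) (j : Fin n) (x : (geoTangent F).obj A) :
    powMap n f (coproj A j x) = coproj B j ((geoTangent F).map f x) := by
  rw [powMap, powDesc_coproj, comp_apply]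

/-- The morphism out of `T°₂(A)` given by two morphisms out of `T°(A)` that agree on `A`. -/
noncomputable def pair (k₀ k₁ : (geoTangent F).obj A ⟶ B)
    (hk : ∀ a, k₀ (geoIncl A a) = k₁ (geoIncl A a)) : geoPow 2 A ⟶ B :=
  powDesc (geoIncl A ≫ k₀) ![k₀, k₁] (Fin.forall_fin_two.2 ⟨fun _ => rfl, fun a => (hk a).symm⟩)

section

variable (k₀ k₁ : (geoTangent F).obj A ⟶ B) (hk : ∀ a, k₀ (geoIncl A a) = k₁ (geoIncl A a))

lemma pair_base (a : A) : pair k₀ k₁ hk (base A 2 a) = k₀ (geoIncl A a) := rfl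

lemma coproj_zero_pair : coproj A 0 ≫ pair k₀ k₁ hk = k₀ := coproj_powDesc _ _ _ _

lemma coproj_one_pair : coproj A 1 ≫ pair k₀ k₁ hk = k₁ := coproj_powDesc _ _ _ _

lemma pair_coproj_zero (x : (geoTangent F).obj A) : pair k₀ k₁ hk (coproj A 0 x) = k₀ x := by
  rw [← comp_apply, coproj_zero_pair]

lemma pair_coproj_one (x : (geoTangent F).obj A) : pair k₀ k₁ hk (coproj A 1 x) = k₁ x := by
  rw [← comp_apply, coproj_one_pair]

end

/-- The morphism out of `T°(T°₂(A))` given by two morphisms out of `T°(T°(A))` that agree on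
`T°(A)`, embedded by `a ↦ a`, `d a ↦ d' a`. It exists since `T°`, being a left adjoint, preserves
the pushout `T°₂(A)`. -/
noncomputable def pairMap (k₀ k₁ : (geoTangent F).obj ((geoTangent F).obj A) ⟶ B)
    (h₁ : ∀ a, k₀ (geoIncl _ (geoIncl A a)) = k₁ (geoIncl _ (geoIncl A a)))
    (h₂ : ∀ a, k₀ (geoD _ (geoIncl A a)) = k₁ (geoD _ (geoIncl A a))) :
    (geoTangent F).obj (geoPow 2 A) ⟶ B :=
  geoDesc (pair (transpose k₀) (transpose k₁) (fun a => algTangent_ext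
    (by simp only [fst_transpose, h₁]) (by simp only [snd_transpose, h₂])))

section

variable (k₀ k₁ : (geoTangent F).obj ((geoTangent F).obj A) ⟶ B)
    (h₁ : ∀ a, k₀ (geoIncl _ (geoIncl A a)) = k₁ (geoIncl _ (geoIncl A a)))
    (h₂ : ∀ a, k₀ (geoD _ (geoIncl A a)) = k₁ (geoD _ (geoIncl A a)))

lemma pairMap_incl_base (a : A) :
    pairMap k₀ k₁ h₁ h₂ (geoIncl _ (base A 2 a)) = k₀ (geoIncl _ (geoIncl A a)) := by
  rw [pairMap, geoDesc_incl, pair_base, fst_transpose]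

lemma pairMap_d_base (a : A) :
    pairMap k₀ k₁ h₁ h₂ (geoD _ (base A 2 a)) = k₀ (geoD _ (geoIncl A a)) := by
  rw [pairMap, geoDesc_d, pair_base, snd_transpose]

lemma pairMap_incl_coproj_zero (x : (geoTangent F).obj A) :
    pairMap k₀ k₁ h₁ h₂ (geoIncl _ (coproj A 0 x)) = k₀ (geoIncl _ x) := by
  rw [pairMap, geoDesc_incl, pair_coproj_zero, fst_transpose]

lemma pairMap_incl_coproj_one (x : (geoTangent F).obj A) :
    pairMap k₀ k₁ h₁ h₂ (geoIncl _ (coproj A 1 x)) = k₁ (geoIncl _ x) := by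
  rw [pairMap, geoDesc_incl, pair_coproj_one, fst_transpose]

lemma pairMap_d_coproj_zero (x : (geoTangent F).obj A) :
    pairMap k₀ k₁ h₁ h₂ (geoD _ (coproj A 0 x)) = k₀ (geoD _ x) := by
  rw [pairMap, geoDesc_d, pair_coproj_zero, snd_transpose]

lemma pairMap_d_coproj_one (x : (geoTangent F).obj A) :
    pairMap k₀ k₁ h₁ h₂ (geoD _ (coproj A 1 x)) = k₁ (geoD _ x) := by
  rw [pairMap, geoDesc_d, pair_coproj_one, snd_transpose]

lemma map_coproj_zero_pairMap :
    (geoTangent F).map (coproj A 0) ≫ pairMap k₀ k₁ h₁ h₂ = k₀ :=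
  geo_hom_ext
    (fun x => by rw [comp_apply, map_geoIncl, pairMap_incl_coproj_zero])
    (fun x => by rw [comp_apply, map_geoD, pairMap_d_coproj_zero])

lemma map_coproj_one_pairMap :
    (geoTangent F).map (coproj A 1) ≫ pairMap k₀ k₁ h₁ h₂ = k₁ :=
  geo_hom_ext
    (fun x => by rw [comp_apply, map_geoIncl, pairMap_incl_coproj_one])
    (fun x => by rw [comp_apply, map_geoD, pairMap_d_coproj_one])

end

/-! ### The structure maps -/

variable (A)

/-- The sum `T°(A) → T°₂(A)`. -/
noncomputable def geoSum : (geoTangent F).obj A ⟶ geoPow 2 A :=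
  geoDesc (algAdd (transpose (coproj A 0)) (transpose (coproj A 1))
    (fun a => by rw [fst_transpose, fst_transpose, coproj_incl, coproj_incl]))

/-- The zero `T°(A) → A`. -/
noncomputable def geoZero : (geoTangent F).obj A ⟶ A := geoDesc (algZero A)

/-- The vertical lift `T°(T°(A)) → T°(A)`. -/
noncomputable def geoLift :
    (geoTangent F).obj ((geoTangent F).obj A) ⟶ (geoTangent F).obj A :=
  geoDesc (geoDesc (geoUnit A ≫ algLift _))

/-- The canonical flip `T°(T°(A)) → T°(T°(A))`. -/
noncomputable def geoFlip :
    (geoTangent F).obj ((geoTangent F).obj A) ⟶ (geoTangent F).obj ((geoTangent F).obj A) :=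
  geoDesc (geoDesc (transpose (geoUnit _) ≫ algFlip _))

/-- The negative `T°(A) → T°(A)`. -/
noncomputable def geoNeg : (geoTangent F).obj A ⟶ (geoTangent F).obj A :=
  geoDesc (geoUnit A ≫ algNeg _)

variable (a : A)

lemma geoSum_incl : geoSum A (geoIncl A a) = base A 2 a := rfl
lemma geoSum_d :
    geoSum A (geoD A a) = coproj A 0 (geoD A a) + coproj A 1 (geoD A a) := by
  rw [geoSum, geoDesc_d, snd_algAdd, snd_transpose, snd_transpose]

lemma geoZero_incl : geoZero A (geoIncl A a) = a := rfl
lemma geoZero_d : geoZero A (geoD A a) = 0 := by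
  rw [geoZero, geoDesc_d, snd_algZero]

lemma geoNeg_incl : geoNeg A (geoIncl A a) = geoIncl A a := rfl
lemma geoNeg_d : geoNeg A (geoD A a) = -geoD A a := by
  rw [geoNeg, geoDesc_d, comp_apply, snd_algNeg, snd_geoUnit]

lemma geoLift_incl_incl : geoLift A (geoIncl _ (geoIncl A a)) = geoIncl A a := by
  rw [geoLift, geoDesc_incl, geoDesc_incl, comp_apply, fst_fst_algLift, fst_geoUnit]
lemma geoLift_incl_d : geoLift A (geoIncl _ (geoD A a)) = 0 := by
  rw [geoLift, geoDesc_incl, geoDesc_d, comp_apply, fst_snd_algLift]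
lemma geoLift_d_incl : geoLift A (geoD _ (geoIncl A a)) = 0 := by
  rw [geoLift, geoDesc_d, geoDesc_incl, comp_apply, snd_fst_algLift]
lemma geoLift_d_d : geoLift A (geoD _ (geoD A a)) = geoD A a := by
  rw [geoLift, geoDesc_d, geoDesc_d, comp_apply, snd_snd_algLift, snd_geoUnit]

lemma geoFlip_incl_incl :
    geoFlip A (geoIncl _ (geoIncl A a)) = geoIncl _ (geoIncl A a) := by
  rw [geoFlip, geoDesc_incl, geoDesc_incl, comp_apply, fst_fst_algFlip, fst_transpose, fst_geoUnit]
lemma geoFlip_incl_d : geoFlip A (geoIncl _ (geoD A a)) = geoD _ (geoIncl A a) := by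
  rw [geoFlip, geoDesc_incl, geoDesc_d, comp_apply, fst_snd_algFlip, fst_transpose, snd_geoUnit]
lemma geoFlip_d_incl : geoFlip A (geoD _ (geoIncl A a)) = geoIncl _ (geoD A a) := by
  rw [geoFlip, geoDesc_d, geoDesc_incl, comp_apply, snd_fst_algFlip, snd_transpose, fst_geoUnit]
lemma geoFlip_d_d : geoFlip A (geoD _ (geoD A a)) = geoD _ (geoD A a) := by
  rw [geoFlip, geoDesc_d, geoDesc_d, comp_apply, snd_snd_algFlip, snd_transpose, snd_geoUnit]

end DPAlg

/-! ### Tangent structures on opposite categories -/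

section

open Limits

variable {C : Type*} [Category C]

/-- A right adjoint preserves wide pullback cones given by explicit projections. -/
lemma nonempty_isLimit_map_widePullbackCone {D : Type*} [Category D] {L : D ⥤ C} {R : C ⥤ D}
    (adj : L ⊣ R) {ι : Type*} {X W : C} {Y : ι → C} (f : ∀ i, Y i ⟶ X) (b : W ⟶ X)
    (π : ∀ i, W ⟶ Y i) (h : ∀ i, π i ≫ f i = b)
    (H : Nonempty (IsLimit (WidePullbackCone.mk b π h)))
    (h' : ∀ i, R.map (π i) ≫ R.map (f i) = R.map b) :
    Nonempty (IsLimit (WidePullbackCone.mk (R.map b) (fun i => R.map (π i)) h')) := by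
  obtain ⟨H⟩ := H
  have lift_exists {V : C} (b' : V ⟶ X) (a : ∀ i, V ⟶ Y i) (w : ∀ i, a i ≫ f i = b') :
      ∃ g : V ⟶ W, g ≫ b = b' ∧ ∀ i, g ≫ π i = a i :=
    ⟨WidePullbackCone.IsLimit.lift H b' a w, WidePullbackCone.IsLimit.lift_base H b' a w,
      WidePullbackCone.IsLimit.lift_π H b' a w⟩
  have lift_unique {V : C} {g g' : V ⟶ W} (hb : g ≫ b = g' ≫ b)
      (hπ : ∀ i, g ≫ π i = g' ≫ π i) : g = g' := WidePullbackCone.IsLimit.hom_ext H hb hπ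
  have transposed (t : WidePullbackCone fun i => R.map (f i)) :
      ∃ g : t.pt ⟶ R.obj W, g ≫ R.map b = t.base ∧ ∀ i, g ≫ R.map (π i) = t.π i := by
    obtain ⟨g, hb, hπ⟩ := lift_exists ((adj.homEquiv _ _).symm t.base)
      (fun i => (adj.homEquiv _ _).symm (t.π i))
      (fun i => by rw [← adj.homEquiv_naturality_right_symm, t.condition])
    refine ⟨adj.homEquiv _ _ g, ?_, fun i => ?_⟩
    · rw [← adj.homEquiv_naturality_right, hb, Equiv.apply_symm_apply]
    · rw [← adj.homEquiv_naturality_right, hπ, Equiv.apply_symm_apply]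
  choose g hb hπ using transposed
  refine ⟨WidePullbackCone.IsLimit.mk _ g hb hπ fun t m hmb hmπ => ?_⟩
  refine (adj.homEquiv _ _).symm.injective (lift_unique ?_ fun i => ?_)
  · exact (adj.homEquiv_naturality_right_symm m b).symm.trans
      ((congrArg _ (hmb.trans (hb t).symm)).trans (adj.homEquiv_naturality_right_symm (g t) b))
  · exact (adj.homEquiv_naturality_right_symm m (π i)).symm.trans
      ((congrArg _ ((hmπ i).trans (hπ t i).symm)).trans
        (adj.homEquiv_naturality_right_symm (g t) (π i)))

lemma nonempty_isLimit_iterFunctor_widePullbackCone {L R : C ⥤ C} (adj : L ⊣ R) {ι : Type*}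
    {X W : C} {Y : ι → C} (f : ∀ i, Y i ⟶ X) (b : W ⟶ X) (π : ∀ i, W ⟶ Y i)
    (h : ∀ i, π i ≫ f i = b) (H : Nonempty (IsLimit (WidePullbackCone.mk b π h))) (m : ℕ)
    (h' : ∀ i, (iterFunctor R m).map (π i) ≫ (iterFunctor R m).map (f i) =
      (iterFunctor R m).map b) :
    Nonempty (IsLimit (WidePullbackCone.mk ((iterFunctor R m).map b)
      (fun i => (iterFunctor R m).map (π i)) h')) := by
  induction m with
  | zero => exact H
  | succ m ih =>
    exact nonempty_isLimit_map_widePullbackCone adj _ _ _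
      (fun i => by rw [← Functor.map_comp, h i])
      (ih fun i => by rw [← Functor.map_comp, h i]) h'

end

section

variable {C : Type*} [Category C]

/-- The data of a Rosický tangent structure on `Cᵒᵖ` with tangent bundle functor `G.op`, read in `C`:
all arrows are reversed, and the universal properties are spelled out for morphisms out of the
pushouts `Tn n` and out of the coequaliser. -/
structure CotangentStructure (G : C ⥤ C) where
  /-- the opposite of the projection -/
  p : ∀ A, A ⟶ G.obj A
  p_naturality : ∀ {A B} (f : A ⟶ B), p A ≫ G.map f = f ≫ p B
  /-- the fibre copowers of `p`, with their coprojections -/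
  Tn : ℕ → (C ⥤ C)
  base : ∀ n A, A ⟶ (Tn n).obj A
  base_naturality : ∀ n {A B} (f : A ⟶ B), base n A ≫ (Tn n).map f = f ≫ base n B
  q : ∀ n, Fin n → ∀ A, G.obj A ⟶ (Tn n).obj A
  q_naturality : ∀ n (j : Fin n) {A B} (f : A ⟶ B),
    q n j A ≫ (Tn n).map f = G.map f ≫ q n j B
  p_q : ∀ n (j : Fin n) A, p A ≫ q n j A = base n A
  existsUnique_desc : ∀ n (A B : C) (b : A ⟶ B) (k : Fin n → (G.obj A ⟶ B)),
    (∀ j, p A ≫ k j = b) → ∃! g : (Tn n).obj A ⟶ B, base n A ≫ g = b ∧ ∀ j, q n j A ≫ g = k j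
  /-- the opposite of the sum -/
  s : ∀ A, G.obj A ⟶ (Tn 2).obj A
  s_naturality : ∀ {A B} (f : A ⟶ B), s A ≫ (Tn 2).map f = G.map f ≫ s B
  /-- the opposite of the zero -/
  z : ∀ A, G.obj A ⟶ A
  z_naturality : ∀ {A B} (f : A ⟶ B), z A ≫ f = G.map f ≫ z B
  /-- the opposite of the vertical lift -/
  l : ∀ A, G.obj (G.obj A) ⟶ G.obj A
  l_naturality : ∀ {A B} (f : A ⟶ B), l A ≫ G.map f = G.map (G.map f) ≫ l B
  /-- the opposite of the canonical flip -/
  c : ∀ A, G.obj (G.obj A) ⟶ G.obj (G.obj A)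
  c_naturality : ∀ {A B} (f : A ⟶ B), c A ≫ G.map (G.map f) = G.map (G.map f) ≫ c B
  /-- the opposite of the negative -/
  n : ∀ A, G.obj A ⟶ G.obj A
  n_naturality : ∀ {A B} (f : A ⟶ B), n A ≫ G.map f = G.map f ≫ n B
  p_s : ∀ A, p A ≫ s A = base 2 A
  p_z : ∀ A, p A ≫ z A = 𝟙 A
  s_assoc : ∀ A, ∃ w₀₁ w₁₂ w w' : (Tn 2).obj A ⟶ (Tn 3).obj A,
    (q 2 0 A ≫ w₀₁ = q 3 0 A ∧ q 2 1 A ≫ w₀₁ = q 3 1 A) ∧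
    (q 2 0 A ≫ w₁₂ = q 3 1 A ∧ q 2 1 A ≫ w₁₂ = q 3 2 A) ∧
    (q 2 0 A ≫ w = s A ≫ w₀₁ ∧ q 2 1 A ≫ w = q 3 2 A) ∧
    (q 2 0 A ≫ w' = q 3 0 A ∧ q 2 1 A ≫ w' = s A ≫ w₁₂) ∧
    s A ≫ w = s A ≫ w'
  s_comm : ∀ A, ∃ w : (Tn 2).obj A ⟶ (Tn 2).obj A,
    q 2 0 A ≫ w = q 2 1 A ∧ q 2 1 A ≫ w = q 2 0 A ∧ s A ≫ w = s A
  s_zero : ∀ A, ∃ w : (Tn 2).obj A ⟶ G.obj A,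
    q 2 0 A ≫ w = 𝟙 (G.obj A) ∧ q 2 1 A ≫ w = z A ≫ p A ∧ s A ≫ w = 𝟙 (G.obj A)
  p_n : ∀ A, p A ≫ n A = p A
  s_neg : ∀ A, ∃ w : (Tn 2).obj A ⟶ G.obj A,
    q 2 0 A ≫ w = 𝟙 (G.obj A) ∧ q 2 1 A ≫ w = n A ∧ s A ≫ w = z A ≫ p A
  p_l : ∀ A, G.map (p A) ≫ l A = z A ≫ p A
  l_z : ∀ A, l A ≫ z A = G.map (z A) ≫ z A
  l_s : ∀ A, ∃ w : G.obj ((Tn 2).obj A) ⟶ (Tn 2).obj A,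
    G.map (q 2 0 A) ≫ w = l A ≫ q 2 0 A ∧ G.map (q 2 1 A) ≫ w = l A ≫ q 2 1 A ∧
    l A ≫ s A = G.map (s A) ≫ w
  p_c : ∀ A, p (G.obj A) ≫ c A = G.map (p A)
  c_z : ∀ A, c A ≫ G.map (z A) = z (G.obj A)
  c_s : ∀ A, ∃ w : (Tn 2).obj (G.obj A) ⟶ G.obj ((Tn 2).obj A),
    q 2 0 (G.obj A) ≫ w = c A ≫ G.map (q 2 0 A) ∧ q 2 1 (G.obj A) ≫ w = c A ≫ G.map (q 2 1 A) ∧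
    c A ≫ G.map (s A) = s (G.obj A) ≫ w
  c_c : ∀ A, c A ≫ c A = 𝟙 (G.obj (G.obj A))
  c_l : ∀ A, c A ≫ l A = l A
  l_l : ∀ A, G.map (l A) ≫ l A = l (G.obj A) ≫ l A
  c_c_c : ∀ A, G.map (c A) ≫ c (G.obj A) ≫ G.map (c A) = c (G.obj A) ≫ G.map (c A) ≫ c (G.obj A)
  c_c_l : ∀ A, c (G.obj A) ≫ G.map (c A) ≫ l (G.obj A) = G.map (l A) ≫ c A
  /-- universality of the vertical lift: with `w = [q₀ ∘ l, q₁ ∘ z]` out of the pushout `G (Tn 2 A)`,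
  the composite `G s ≫ w` is a coequaliser of `G p` and `z ≫ p ≫ p` -/
  universal : ∀ A, ∃ w : G.obj ((Tn 2).obj A) ⟶ (Tn 2).obj A,
    G.map (q 2 0 A) ≫ w = l A ≫ q 2 0 A ∧ G.map (q 2 1 A) ≫ w = z (G.obj A) ≫ q 2 1 A ∧
    G.map (p A) ≫ G.map (s A) ≫ w = ((z A ≫ p A) ≫ p (G.obj A)) ≫ G.map (s A) ≫ w ∧
    ∀ (B : C) (k : G.obj (G.obj A) ⟶ B), G.map (p A) ≫ k = ((z A ≫ p A) ≫ p (G.obj A)) ≫ k →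
      ∃! g : (Tn 2).obj A ⟶ B, (G.map (s A) ≫ w) ≫ g = k

namespace CotangentStructure

open Limits

variable {G : C ⥤ C} (S : CotangentStructure G)

lemma nonempty_isLimit (n : ℕ) (A : C)
    (h : ∀ j : Fin n, (S.q n j A).op ≫ (S.p A).op = (S.base n A).op) :
    Nonempty (IsLimit (WidePullbackCone.mk (f := fun _ : Fin n => (S.p A).op)
      (S.base n A).op (fun j => (S.q n j A).op) h)) := by
  have H (t : WidePullbackCone fun _ : Fin n => (S.p A).op) :=
    S.existsUnique_desc n A _ t.base.unop (fun j => (t.π j).unop)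
      fun j => congrArg Quiver.Hom.unop (t.condition j)
  choose g hg hu using H
  exact ⟨WidePullbackCone.IsLimit.mk _ (fun t => (g t).op)
    (fun t => congrArg Quiver.Hom.op (hg t).1)
    (fun t j => congrArg Quiver.Hom.op ((hg t).2 j))
    fun t m hb hπ => congrArg Quiver.Hom.op (hu t m.unop
      ⟨congrArg Quiver.Hom.unop hb, fun j => congrArg Quiver.Hom.unop (hπ j)⟩)⟩

/-- The Rosický tangent structure on `Cᵒᵖ`. If `G` has a right adjoint, it preserves the pushouts
`Tn n`, as required of a tangent structure. -/
def toRosicky {R : C ⥤ C} (adj : G ⊣ R) : RosickyTangentStructure G.op where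
  p := { app := fun X => (S.p X.unop).op
         naturality := fun _ _ f => congrArg Quiver.Hom.op (S.p_naturality f.unop) }
  Tn n := (S.Tn n).op
  base n := { app := fun X => (S.base n X.unop).op
              naturality := fun _ _ f => congrArg Quiver.Hom.op (S.base_naturality n f.unop) }
  q n j := { app := fun X => (S.q n j X.unop).op
             naturality := fun _ _ f => congrArg Quiver.Hom.op (S.q_naturality n j f.unop) }
  q_p n j X := congrArg Quiver.Hom.op (S.p_q n j X.unop)
  isLimit m n X := nonempty_isLimit_iterFunctor_widePullbackCone adj.op _ _ _ _
    (S.nonempty_isLimit n X.unop fun j => congrArg Quiver.Hom.op (S.p_q n j X.unop)) m _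
  s := { app := fun X => (S.s X.unop).op
         naturality := fun _ _ f => congrArg Quiver.Hom.op (S.s_naturality f.unop) }
  z := { app := fun X => (S.z X.unop).op
         naturality := fun _ _ f => congrArg Quiver.Hom.op (S.z_naturality f.unop) }
  l := { app := fun X => (S.l X.unop).op
         naturality := fun _ _ f => congrArg Quiver.Hom.op (S.l_naturality f.unop) }
  c := { app := fun X => (S.c X.unop).op
         naturality := fun _ _ f => congrArg Quiver.Hom.op (S.c_naturality f.unop) }
  n := { app := fun X => (S.n X.unop).op
         naturality := fun _ _ f => congrArg Quiver.Hom.op (S.n_naturality f.unop) }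
  s_p X := congrArg Quiver.Hom.op (S.p_s X.unop)
  z_p X := congrArg Quiver.Hom.op (S.p_z X.unop)
  s_assoc X := by
    obtain ⟨w₀₁, w₁₂, w, w', ⟨h₁, h₂⟩, ⟨h₃, h₄⟩, ⟨h₅, h₆⟩, ⟨h₇, h₈⟩, h₉⟩ := S.s_assoc X.unop
    exact ⟨w₀₁.op, w₁₂.op, w.op, w'.op,
      ⟨congrArg Quiver.Hom.op h₁, congrArg Quiver.Hom.op h₂⟩,
      ⟨congrArg Quiver.Hom.op h₃, congrArg Quiver.Hom.op h₄⟩,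
      ⟨congrArg Quiver.Hom.op h₅, congrArg Quiver.Hom.op h₆⟩,
      ⟨congrArg Quiver.Hom.op h₇, congrArg Quiver.Hom.op h₈⟩, congrArg Quiver.Hom.op h₉⟩
  s_comm X := by
    obtain ⟨w, h₁, h₂, h₃⟩ := S.s_comm X.unop
    exact ⟨w.op, congrArg Quiver.Hom.op h₁, congrArg Quiver.Hom.op h₂, congrArg Quiver.Hom.op h₃⟩
  s_zero X := by
    obtain ⟨w, h₁, h₂, h₃⟩ := S.s_zero X.unop
    exact ⟨w.op, congrArg Quiver.Hom.op h₁, congrArg Quiver.Hom.op h₂, congrArg Quiver.Hom.op h₃⟩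
  n_p X := congrArg Quiver.Hom.op (S.p_n X.unop)
  s_neg X := by
    obtain ⟨w, h₁, h₂, h₃⟩ := S.s_neg X.unop
    exact ⟨w.op, congrArg Quiver.Hom.op h₁, congrArg Quiver.Hom.op h₂, congrArg Quiver.Hom.op h₃⟩
  l_p X := congrArg Quiver.Hom.op (S.p_l X.unop)
  z_l X := congrArg Quiver.Hom.op (S.l_z X.unop)
  s_l X := by
    obtain ⟨w, h₁, h₂, h₃⟩ := S.l_s X.unop
    exact ⟨w.op, congrArg Quiver.Hom.op h₁, congrArg Quiver.Hom.op h₂, congrArg Quiver.Hom.op h₃⟩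
  c_p X := congrArg Quiver.Hom.op (S.p_c X.unop)
  z_c X := congrArg Quiver.Hom.op (S.c_z X.unop)
  s_c X := by
    obtain ⟨w, h₁, h₂, h₃⟩ := S.c_s X.unop
    exact ⟨w.op, congrArg Quiver.Hom.op h₁, congrArg Quiver.Hom.op h₂, congrArg Quiver.Hom.op h₃⟩
  c_c X := congrArg Quiver.Hom.op (S.c_c X.unop)
  l_c X := congrArg Quiver.Hom.op (S.c_l X.unop)
  l_l X := congrArg Quiver.Hom.op (S.l_l X.unop)
  c_c_c X := by
    refine Quiver.Hom.unop_inj ?_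
    simpa using S.c_c_c X.unop
  l_c_c X := by
    refine Quiver.Hom.unop_inj ?_
    simpa using S.c_c_l X.unop
  universal X := by
    obtain ⟨w, h₀, h₁, h, H⟩ := S.universal X.unop
    refine ⟨w.op, congrArg Quiver.Hom.op h, congrArg Quiver.Hom.op h₀, congrArg Quiver.Hom.op h₁,
      ⟨Fork.IsLimit.mk' _ fun t => ?_⟩⟩
    have Ht := H t.pt.unop t.ι.unop (congrArg Quiver.Hom.unop t.condition)
    exact ⟨Ht.choose.op, congrArg Quiver.Hom.op Ht.choose_spec.1, fun {m} hm =>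
      congrArg Quiver.Hom.op (Ht.choose_spec.2 m.unop (congrArg Quiver.Hom.unop hm))⟩

end CotangentStructure

end

/-! ### Coherence of the vertical lift and the flip -/

namespace DPAlg

variable {F : Type u} [Field F]

open Limits

/-- The functor `T°ₙ`. -/
noncomputable def geoPowFunctor (n : ℕ) : DPAlg.{u} F ⥤ DPAlg.{u} F where
  obj := geoPow n
  map := powMap n
  map_id A := pow_hom_ext_d (fun a => by rw [powMap_base]; rfl) (fun j a => by
    rw [powMap_coproj, map_geoD]; rfl)
  map_comp f g := pow_hom_ext_d (fun a => rfl) (fun j a => by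
    rw [comp_apply, powMap_coproj, powMap_coproj, powMap_coproj, Functor.map_comp, comp_apply])

variable (A : DPAlg.{u} F)

lemma incl_sum : geoIncl A ≫ geoSum A = base A 2 := rfl

lemma incl_zero : geoIncl A ≫ geoZero A = 𝟙 A := rfl

lemma flip_flip : geoFlip A ≫ geoFlip A = 𝟙 _ :=
  geo_hom_ext₂
    (fun a => by rw [comp_apply, geoFlip_incl_incl, geoFlip_incl_incl, id_apply])
    (fun a => by rw [comp_apply, geoFlip_incl_d, geoFlip_d_incl, id_apply])
    (fun a => by rw [comp_apply, geoFlip_d_incl, geoFlip_incl_d, id_apply])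
    (fun a => by rw [comp_apply, geoFlip_d_d, geoFlip_d_d, id_apply])

lemma flip_lift : geoFlip A ≫ geoLift A = geoLift A :=
  geo_hom_ext₂
    (fun a => by rw [comp_apply, geoFlip_incl_incl])
    (fun a => by rw [comp_apply, geoFlip_incl_d, geoLift_incl_d, geoLift_d_incl])
    (fun a => by rw [comp_apply, geoFlip_d_incl, geoLift_incl_d, geoLift_d_incl])
    (fun a => by rw [comp_apply, geoFlip_d_d])

lemma map_incl_lift : (geoTangent F).map (geoIncl A) ≫ geoLift A = geoZero A ≫ geoIncl A :=
  geo_hom_ext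
    (fun a => by
      rw [comp_apply, comp_apply, map_geoIncl, geoLift_incl_incl, geoZero_incl])
    (fun a => by
      rw [comp_apply, comp_apply, map_geoD, geoLift_d_incl, geoZero_d, map_zero])

lemma lift_zero : geoLift A ≫ geoZero A = (geoTangent F).map (geoZero A) ≫ geoZero A :=
  geo_hom_ext₂
    (fun a => by
      rw [comp_apply, comp_apply, map_geoIncl, geoLift_incl_incl, geoZero_incl, geoZero_incl])
    (fun a => by
      rw [comp_apply, comp_apply, map_geoIncl, geoLift_incl_d, geoZero_incl, geoZero_d, map_zero])
    (fun a => by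
      rw [comp_apply, comp_apply, map_geoD, geoLift_d_incl, geoZero_d, map_zero])
    (fun a => by
      rw [comp_apply, comp_apply, map_geoD, geoLift_d_d, geoZero_d, geoZero_d])

lemma incl_flip : geoIncl _ ≫ geoFlip A = (geoTangent F).map (geoIncl A) :=
  geo_hom_ext
    (fun a => by rw [comp_apply, geoFlip_incl_incl, map_geoIncl])
    (fun a => by rw [comp_apply, geoFlip_incl_d, map_geoD])

lemma flip_map_zero : geoFlip A ≫ (geoTangent F).map (geoZero A) = geoZero _ :=
  geo_hom_ext₂
    (fun a => by
      rw [comp_apply, geoFlip_incl_incl, map_geoIncl, geoZero_incl, geoZero_incl])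
    (fun a => by
      rw [comp_apply, geoFlip_incl_d, map_geoD, geoZero_incl, geoZero_incl])
    (fun a => by
      rw [comp_apply, geoFlip_d_incl, map_geoIncl, geoZero_d, geoZero_d, map_zero])
    (fun a => by
      rw [comp_apply, geoFlip_d_d, map_geoD, geoZero_d, geoZero_d, geoD_zero])

lemma map_lift_lift : (geoTangent F).map (geoLift A) ≫ geoLift A = geoLift _ ≫ geoLift A :=
  geo_hom_ext₃
    (fun a => by simp only [comp_apply, map_geoIncl, geoLift_incl_incl])
    (fun a => by simp only [comp_apply, map_geoIncl, geoLift_incl_incl, geoLift_incl_d, map_zero])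
    (fun a => by simp only [comp_apply, map_geoIncl, geoLift_incl_d, geoLift_d_incl, map_zero])
    (fun a => by simp only [comp_apply, map_geoIncl, geoLift_incl_d, geoLift_d_d, map_zero])
    (fun a => by simp only [comp_apply, map_geoD, geoLift_incl_incl, geoLift_d_incl, map_zero])
    (fun a => by
      simp only [comp_apply, map_geoD, geoLift_incl_d, geoLift_d_incl, geoD_zero, map_zero])
    (fun a => by
      simp only [comp_apply, map_geoD, geoLift_d_incl, geoLift_d_d, geoD_zero, map_zero])
    (fun a => by simp only [comp_apply, map_geoD, geoLift_d_d])

lemma flip_flip_flip :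
    (geoTangent F).map (geoFlip A) ≫ geoFlip _ ≫ (geoTangent F).map (geoFlip A) =
      geoFlip _ ≫ (geoTangent F).map (geoFlip A) ≫ geoFlip _ := by
  refine geo_hom_ext₃ ?_ ?_ ?_ ?_ ?_ ?_ ?_ ?_ <;> intro a <;>
    simp only [comp_apply, map_geoIncl, map_geoD, geoFlip_incl_incl, geoFlip_incl_d,
      geoFlip_d_incl, geoFlip_d_d]

lemma flip_map_flip_lift :
    geoFlip _ ≫ (geoTangent F).map (geoFlip A) ≫ geoLift _ =
      (geoTangent F).map (geoLift A) ≫ geoFlip A := by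
  refine geo_hom_ext₃ ?_ ?_ ?_ ?_ ?_ ?_ ?_ ?_ <;> intro a <;>
    simp only [comp_apply, map_geoIncl, map_geoD, geoFlip_incl_incl, geoFlip_incl_d,
      geoFlip_d_incl, geoFlip_d_d, geoLift_incl_incl, geoLift_incl_d, geoLift_d_incl, geoLift_d_d,
      map_zero, geoD_zero]

end DPAlg

namespace DPAlg

variable {F : Type u} [Field F] {A B : DPAlg.{u} F}

open Limits

/-! ### Naturality of the structure maps -/

lemma incl_naturality (f : A ⟶ B) : geoIncl A ≫ (geoTangent F).map f = f ≫ geoIncl B := rfl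

lemma coproj_naturality {n : ℕ} (f : A ⟶ B) (j : Fin n) :
    coproj A j ≫ powMap n f = (geoTangent F).map f ≫ coproj B j :=
  hom_ext (powMap_coproj f j)

lemma sum_naturality (f : A ⟶ B) :
    geoSum A ≫ powMap 2 f = (geoTangent F).map f ≫ geoSum B :=
  geo_hom_ext
    (fun a => by rw [comp_apply, comp_apply, map_geoIncl, geoSum_incl, geoSum_incl, powMap_base])
    (fun a => by
      rw [comp_apply, comp_apply, map_geoD, geoSum_d, geoSum_d, map_add, powMap_coproj,
        powMap_coproj, map_geoD])

lemma zero_naturality (f : A ⟶ B) : geoZero A ≫ f = (geoTangent F).map f ≫ geoZero B :=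
  geo_hom_ext
    (fun a => by rw [comp_apply, comp_apply, map_geoIncl, geoZero_incl, geoZero_incl])
    (fun a => by rw [comp_apply, comp_apply, map_geoD, geoZero_d, geoZero_d, map_zero])

lemma neg_naturality (f : A ⟶ B) :
    geoNeg A ≫ (geoTangent F).map f = (geoTangent F).map f ≫ geoNeg B :=
  geo_hom_ext
    (fun a => by rw [comp_apply, comp_apply, map_geoIncl, geoNeg_incl, geoNeg_incl, map_geoIncl])
    (fun a => by rw [comp_apply, comp_apply, map_geoD, geoNeg_d, geoNeg_d, map_neg, map_geoD])

lemma lift_naturality (f : A ⟶ B) :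
    geoLift A ≫ (geoTangent F).map f =
      (geoTangent F).map ((geoTangent F).map f) ≫ geoLift B := by
  refine geo_hom_ext₂ ?_ ?_ ?_ ?_ <;> intro a <;>
    simp only [comp_apply, map_geoIncl, map_geoD, geoLift_incl_incl, geoLift_incl_d,
      geoLift_d_incl, geoLift_d_d, map_zero]

lemma flip_naturality (f : A ⟶ B) :
    geoFlip A ≫ (geoTangent F).map ((geoTangent F).map f) =
      (geoTangent F).map ((geoTangent F).map f) ≫ geoFlip B := by
  refine geo_hom_ext₂ ?_ ?_ ?_ ?_ <;> intro a <;>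
    simp only [comp_apply, map_geoIncl, map_geoD, geoFlip_incl_incl, geoFlip_incl_d,
      geoFlip_d_incl, geoFlip_d_d]

/-! ### The additive structure -/

variable (A)

/-- The morphism `T°₂(A) → T°ₙ(A)` that sends the two copies of `T°(A)` to the copies with indices
`i` and `j`. -/
noncomputable def pairCoproj {n : ℕ} (i j : Fin n) : geoPow 2 A ⟶ geoPow n A :=
  pair (coproj A i) (coproj A j) (fun a => by rw [coproj_incl, coproj_incl])

lemma coproj_zero_pairCoproj {n : ℕ} (i j : Fin n) :
    coproj A 0 ≫ pairCoproj A i j = coproj A i := coproj_zero_pair _ _ _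

lemma coproj_one_pairCoproj {n : ℕ} (i j : Fin n) :
    coproj A 1 ≫ pairCoproj A i j = coproj A j := coproj_one_pair _ _ _

lemma sum_pairCoproj_incl {n : ℕ} (i j : Fin n) (a : A) :
    (geoSum A ≫ pairCoproj A i j) (geoIncl A a) = base A n a := by
  rw [comp_apply, geoSum_incl, pairCoproj, pair_base, coproj_incl]

lemma sum_pairCoproj_d {n : ℕ} (i j : Fin n) (a : A) :
    (geoSum A ≫ pairCoproj A i j) (geoD A a) =
      coproj A i (geoD A a) + coproj A j (geoD A a) := by
  rw [comp_apply, geoSum_d, map_add, pairCoproj, pair_coproj_zero, pair_coproj_one]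

lemma sum_assoc :
    ∃ w₀₁ w₁₂ w w' : geoPow 2 A ⟶ geoPow 3 A,
      (coproj A 0 ≫ w₀₁ = coproj A 0 ∧ coproj A 1 ≫ w₀₁ = coproj A 1) ∧
      (coproj A 0 ≫ w₁₂ = coproj A 1 ∧ coproj A 1 ≫ w₁₂ = coproj A 2) ∧
      (coproj A 0 ≫ w = geoSum A ≫ w₀₁ ∧ coproj A 1 ≫ w = coproj A 2) ∧
      (coproj A 0 ≫ w' = coproj A 0 ∧ coproj A 1 ≫ w' = geoSum A ≫ w₁₂) ∧
      geoSum A ≫ w = geoSum A ≫ w' := by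
  refine ⟨pairCoproj A 0 1, pairCoproj A 1 2,
    pair (geoSum A ≫ pairCoproj A 0 1) (coproj A 2)
      (fun a => by rw [sum_pairCoproj_incl, coproj_incl]),
    pair (coproj A 0) (geoSum A ≫ pairCoproj A 1 2)
      (fun a => by rw [sum_pairCoproj_incl, coproj_incl]),
    ⟨coproj_zero_pairCoproj A _ _, coproj_one_pairCoproj A _ _⟩,
    ⟨coproj_zero_pairCoproj A _ _, coproj_one_pairCoproj A _ _⟩,
    ⟨coproj_zero_pair _ _ _, coproj_one_pair _ _ _⟩,
    ⟨coproj_zero_pair _ _ _, coproj_one_pair _ _ _⟩, geo_hom_ext (fun a => ?_) (fun a => ?_)⟩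
  · rw [comp_apply, comp_apply, geoSum_incl, pair_base, pair_base, sum_pairCoproj_incl,
      coproj_incl]
  · rw [comp_apply, comp_apply, geoSum_d, map_add, map_add, pair_coproj_zero, pair_coproj_zero,
      pair_coproj_one, pair_coproj_one, sum_pairCoproj_d, sum_pairCoproj_d, add_assoc]

lemma sum_comm :
    ∃ w : geoPow 2 A ⟶ geoPow 2 A,
      coproj A 0 ≫ w = coproj A 1 ∧ coproj A 1 ≫ w = coproj A 0 ∧ geoSum A ≫ w = geoSum A := by
  refine ⟨pairCoproj A 1 0, coproj_zero_pairCoproj A _ _, coproj_one_pairCoproj A _ _,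
    geo_hom_ext (fun a => ?_) (fun a => ?_)⟩
  · rw [sum_pairCoproj_incl, geoSum_incl]
  · rw [sum_pairCoproj_d, geoSum_d, add_comm]

lemma sum_zero :
    ∃ w : geoPow 2 A ⟶ (geoTangent F).obj A,
      coproj A 0 ≫ w = 𝟙 _ ∧ coproj A 1 ≫ w = geoZero A ≫ geoIncl A ∧ geoSum A ≫ w = 𝟙 _ := by
  refine ⟨pair (𝟙 _) (geoZero A ≫ geoIncl A) (fun a => by
    rw [comp_apply, geoZero_incl, id_apply]), coproj_zero_pair _ _ _, coproj_one_pair _ _ _,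
    geo_hom_ext (fun a => ?_) (fun a => ?_)⟩
  · rw [comp_apply, geoSum_incl, pair_base]
  · rw [comp_apply, geoSum_d, map_add, pair_coproj_zero, pair_coproj_one, comp_apply, geoZero_d,
      map_zero, add_zero]

lemma incl_neg : geoIncl A ≫ geoNeg A = geoIncl A := hom_ext (geoNeg_incl A)

lemma sum_neg :
    ∃ w : geoPow 2 A ⟶ (geoTangent F).obj A,
      coproj A 0 ≫ w = 𝟙 _ ∧ coproj A 1 ≫ w = geoNeg A ∧
      geoSum A ≫ w = geoZero A ≫ geoIncl A := by
  refine ⟨pair (𝟙 _) (geoNeg A) (fun a => by rw [geoNeg_incl, id_apply]), coproj_zero_pair _ _ _,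
    coproj_one_pair _ _ _, geo_hom_ext (fun a => ?_) (fun a => ?_)⟩
  · rw [comp_apply, geoSum_incl, pair_base, comp_apply, geoZero_incl, id_apply]
  · rw [comp_apply, geoSum_d, map_add, pair_coproj_zero, pair_coproj_one, comp_apply, geoZero_d,
      map_zero, geoNeg_d, id_apply, add_neg_cancel]

lemma lift_sum :
    ∃ w : (geoTangent F).obj (geoPow 2 A) ⟶ geoPow 2 A,
      (geoTangent F).map (coproj A 0) ≫ w = geoLift A ≫ coproj A 0 ∧
      (geoTangent F).map (coproj A 1) ≫ w = geoLift A ≫ coproj A 1 ∧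
      geoLift A ≫ geoSum A = (geoTangent F).map (geoSum A) ≫ w := by
  refine ⟨pairMap (geoLift A ≫ coproj A 0) (geoLift A ≫ coproj A 1)
    (fun a => by simp only [comp_apply, geoLift_incl_incl, coproj_incl])
    (fun a => by simp only [comp_apply, geoLift_d_incl, map_zero]),
    map_coproj_zero_pairMap _ _ _ _, map_coproj_one_pairMap _ _ _ _, ?_⟩
  refine geo_hom_ext₂ ?_ ?_ ?_ ?_ <;> intro a <;>
    simp only [comp_apply, map_geoIncl, map_geoD, geoSum_incl, geoSum_d, map_add, geoD_add,
      pairMap_incl_base, pairMap_d_base, pairMap_incl_coproj_zero, pairMap_incl_coproj_one,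
      pairMap_d_coproj_zero, pairMap_d_coproj_one, geoLift_incl_incl, geoLift_incl_d,
      geoLift_d_incl, geoLift_d_d, coproj_incl, map_zero, add_zero]

lemma flip_sum :
    ∃ w : geoPow 2 ((geoTangent F).obj A) ⟶ (geoTangent F).obj (geoPow 2 A),
      coproj _ 0 ≫ w = geoFlip A ≫ (geoTangent F).map (coproj A 0) ∧
      coproj _ 1 ≫ w = geoFlip A ≫ (geoTangent F).map (coproj A 1) ∧
      geoFlip A ≫ (geoTangent F).map (geoSum A) = geoSum _ ≫ w := by
  have h (j : Fin 2) : geoIncl _ ≫ geoFlip A ≫ (geoTangent F).map (coproj A j) =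
      (geoTangent F).map (base A 2) := by
    rw [← Category.assoc, incl_flip, ← Functor.map_comp]
    rfl
  have h' (x : (geoTangent F).obj A) :
      (geoFlip A ≫ (geoTangent F).map (coproj A 0)) (geoIncl _ x) =
        (geoFlip A ≫ (geoTangent F).map (coproj A 1)) (geoIncl _ x) :=
    ConcreteCategory.congr_hom ((h 0).trans (h 1).symm) x
  refine ⟨pair (geoFlip A ≫ (geoTangent F).map (coproj A 0))
    (geoFlip A ≫ (geoTangent F).map (coproj A 1)) h',
    coproj_zero_pair _ _ _, coproj_one_pair _ _ _, ?_⟩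
  refine geo_hom_ext₂ ?_ ?_ ?_ ?_ <;> intro a <;>
    simp only [comp_apply, map_geoIncl, map_geoD, geoSum_incl, geoSum_d, map_add, geoD_add,
      pair_base, pair_coproj_zero, pair_coproj_one, geoFlip_incl_incl, geoFlip_incl_d,
      geoFlip_d_incl, geoFlip_d_d, coproj_incl]

/-! ### Universality of the vertical lift -/

lemma lift_coproj_zero_incl (a : A) :
    (geoLift A ≫ coproj A (0 : Fin 2)) (geoIncl _ (geoIncl A a)) =
      (geoZero _ ≫ coproj A (1 : Fin 2)) (geoIncl _ (geoIncl A a)) := by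
  rw [comp_apply, comp_apply, geoLift_incl_incl, geoZero_incl, coproj_incl, coproj_incl]

lemma lift_coproj_zero_d (a : A) :
    (geoLift A ≫ coproj A (0 : Fin 2)) (geoD _ (geoIncl A a)) =
      (geoZero _ ≫ coproj A (1 : Fin 2)) (geoD _ (geoIncl A a)) := by
  rw [comp_apply, comp_apply, geoLift_d_incl, geoZero_d, map_zero, map_zero]

/-- The morphism `T°(T°₂(A)) → T°₂(A)` whose restrictions along the two coprojections are the
vertical lift and the zero. -/
noncomputable def liftZero : (geoTangent F).obj (geoPow 2 A) ⟶ geoPow 2 A :=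
  pairMap (geoLift A ≫ coproj A 0) (geoZero _ ≫ coproj A 1) (lift_coproj_zero_incl A)
    (lift_coproj_zero_d A)

lemma map_coproj_zero_liftZero :
    (geoTangent F).map (coproj A 0) ≫ liftZero A = geoLift A ≫ coproj A 0 :=
  map_coproj_zero_pairMap _ _ _ _

lemma map_coproj_one_liftZero :
    (geoTangent F).map (coproj A 1) ≫ liftZero A = geoZero _ ≫ coproj A 1 :=
  map_coproj_one_pairMap _ _ _ _

/-- The coequaliser `T°T°A → T°₂(A)` of `T°(p°)` and `p° ∘ p° ∘ z°`. On generators it is given by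
`a ↦ a`, `d a ↦ d₁ a`, `d' a ↦ 0`, `d' d a ↦ d₀ a`, where `d₀` and `d₁` belong to the two copies of
`T°(A)`. -/
noncomputable def verticalCofork :
    (geoTangent F).obj ((geoTangent F).obj A) ⟶ geoPow 2 A :=
  (geoTangent F).map (geoSum A) ≫ liftZero A

lemma verticalCofork_incl_incl (a : A) :
    verticalCofork A (geoIncl _ (geoIncl A a)) = base A 2 a := by
  simp only [verticalCofork, liftZero, comp_apply, map_geoIncl, geoSum_incl, pairMap_incl_base,
    geoLift_incl_incl, coproj_incl]

lemma verticalCofork_incl_d (a : A) :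
    verticalCofork A (geoIncl _ (geoD A a)) = coproj A 1 (geoD A a) := by
  simp only [verticalCofork, liftZero, comp_apply, map_geoIncl, geoSum_d, map_add,
    pairMap_incl_coproj_zero, pairMap_incl_coproj_one, geoLift_incl_d, geoZero_incl, map_zero,
    zero_add]

lemma verticalCofork_d_incl (a : A) : verticalCofork A (geoD _ (geoIncl A a)) = 0 := by
  simp only [verticalCofork, liftZero, comp_apply, map_geoD, geoSum_incl, pairMap_d_base,
    geoLift_d_incl, map_zero]

lemma verticalCofork_d_d (a : A) :
    verticalCofork A (geoD _ (geoD A a)) = coproj A 0 (geoD A a) := by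
  simp only [verticalCofork, liftZero, comp_apply, map_geoD, geoSum_d, map_add, geoD_add,
    pairMap_d_coproj_zero, pairMap_d_coproj_one, geoLift_d_d, geoZero_d, map_zero, add_zero]

lemma verticalCofork_condition :
    (geoTangent F).map (geoIncl A) ≫ verticalCofork A =
      ((geoZero A ≫ geoIncl A) ≫ geoIncl _) ≫ verticalCofork A :=
  geo_hom_ext
    (fun a => by simp only [comp_apply, map_geoIncl, geoZero_incl])
    (fun a => by simp only [comp_apply, map_geoD, geoZero_d, map_zero, verticalCofork_d_incl])

variable {A} in
lemma verticalCofork_epi {g h : geoPow 2 A ⟶ B}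
    (H : verticalCofork A ≫ g = verticalCofork A ≫ h) : g = h := by
  refine pow_hom_ext_d (fun a => ?_) (Fin.forall_fin_two.2 ⟨fun a => ?_, fun a => ?_⟩)
  · rw [← verticalCofork_incl_incl, ← comp_apply, H, comp_apply]
  · rw [← verticalCofork_d_d, ← comp_apply, H, comp_apply]
  · rw [← verticalCofork_incl_d, ← comp_apply, H, comp_apply]

variable {A} in
/-- A morphism out of `T°T°A` that kills all `d' a` factors through `T°₂(A)`. -/
lemma exists_verticalCofork_comp_eq (k : (geoTangent F).obj ((geoTangent F).obj A) ⟶ B)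
    (hk : (geoTangent F).map (geoIncl A) ≫ k =
      ((geoZero A ≫ geoIncl A) ≫ geoIncl _) ≫ k) :
    ∃ g : geoPow 2 A ⟶ B, verticalCofork A ≫ g = k := by
  have hd (a : A) : snd (fst (transpose (transpose k) a)) = 0 := by
    have := ConcreteCategory.congr_hom hk (geoD A a)
    simpa only [fst_transpose, snd_transpose, comp_apply, map_geoD, geoZero_d, map_zero] using this
  -- The restrictions to the two copies of `T°(A)` are read off from the values `d₀ a = d' d a` and
  -- `d₁ a = d a` of the quotient map.
  refine ⟨pair (geoDesc (algDiag (transpose (transpose k)) hd)) (geoIncl _ ≫ k) (fun a => ?_), ?_⟩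
  · rw [geoDesc_incl, fst_algDiag, fst_transpose, fst_transpose, comp_apply]
  · refine geo_hom_ext₂ ?_ ?_ ?_ ?_ <;> intro a
    · rw [comp_apply, verticalCofork_incl_incl, pair_base, geoDesc_incl, fst_algDiag,
        fst_transpose, fst_transpose]
    · rw [comp_apply, verticalCofork_incl_d, pair_coproj_one, comp_apply]
    · rw [comp_apply, verticalCofork_d_incl, map_zero, ← hd, fst_transpose,
        snd_transpose]
    · rw [comp_apply, verticalCofork_d_d, pair_coproj_zero, geoDesc_d, snd_algDiag, snd_transpose,
        snd_transpose]

/-! ### The tangent structure -/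

lemma existsUnique_verticalCofork_comp_eq {B : DPAlg.{u} F}
    (k : (geoTangent F).obj ((geoTangent F).obj A) ⟶ B)
    (hk : (geoTangent F).map (geoIncl A) ≫ k =
      ((geoZero A ≫ geoIncl A) ≫ geoIncl _) ≫ k) :
    ∃! g : geoPow 2 A ⟶ B, ((geoTangent F).map (geoSum A) ≫ liftZero A) ≫ g = k := by
  obtain ⟨g, hg⟩ := exists_verticalCofork_comp_eq k hk
  exact ⟨g, hg, fun g' hg' => verticalCofork_epi (hg'.trans hg.symm)⟩

/-- The tangent structure on the opposite of the category of divided power algebras, read in that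
category. -/
noncomputable def geoCotangentStructure (F : Type u) [Field F] :
    CotangentStructure (geoTangent.{u} F) where
  p := geoIncl
  p_naturality f := incl_naturality f
  Tn := geoPowFunctor
  base n A := base A n
  base_naturality _ _ _ _ := rfl
  q n j A := coproj A j
  q_naturality _ j _ _ f := coproj_naturality f j
  p_q _ _ _ := rfl
  existsUnique_desc n A B b k h := by
    refine ⟨powDesc b k fun j => ConcreteCategory.congr_hom (h j),
      ⟨rfl, coproj_powDesc _ _ _⟩, fun g hg => pow_hom_ext (fun a => ?_) fun j => ?_⟩
    · exact ConcreteCategory.congr_hom hg.1 a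
    · exact (hg.2 j).trans (coproj_powDesc _ _ _ j).symm
  s := geoSum
  s_naturality f := sum_naturality f
  z := geoZero
  z_naturality f := zero_naturality f
  l := geoLift
  l_naturality f := lift_naturality f
  c := geoFlip
  c_naturality f := flip_naturality f
  n := geoNeg
  n_naturality f := neg_naturality f
  p_s := incl_sum
  p_z := incl_zero
  s_assoc := sum_assoc
  s_comm := sum_comm
  s_zero := sum_zero
  p_n := incl_neg
  s_neg := sum_neg
  p_l := map_incl_lift
  l_z := lift_zero
  l_s := lift_sum
  p_c := incl_flip
  c_z := flip_map_zero
  c_s := flip_sum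
  c_c := flip_flip
  c_l := flip_lift
  l_l := map_lift_lift
  c_c_c := flip_flip_flip
  c_c_l := flip_map_flip_lift
  universal A := ⟨liftZero A, map_coproj_zero_liftZero A, map_coproj_one_liftZero A,
    verticalCofork_condition A, fun _ k hk => existsUnique_verticalCofork_comp_eq A k hk⟩

end DPAlg

namespace DPAlg

variable {F : Type u} [Field F]

/-! ### Mates of the structure maps -/

section Mates

variable {A B : DPAlg.{u} F} (a : A)

lemma transpose_sum_comp (f : geoPow 2 A ⟶ B) :
    transpose (geoSum A ≫ f) a =
      Semidirect.algS (transpose (coproj A 0 ≫ f) a) (transpose (coproj A 1 ≫ f) a) :=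
  algTangent_ext
    (by
      change _ = fst (transpose (coproj A 0 ≫ f) a)
      rw [fst_transpose, fst_transpose, comp_apply, comp_apply, geoSum_incl, coproj_incl])
    (by
      change _ = snd (transpose (coproj A 0 ≫ f) a) + snd (transpose (coproj A 1 ≫ f) a)
      rw [snd_transpose, snd_transpose, snd_transpose, comp_apply, comp_apply, comp_apply,
        geoSum_d, map_add])

lemma transpose_zero_comp (f : A ⟶ B) :
    transpose (geoZero A ≫ f) a = Semidirect.algZ (f a) :=
  algTangent_ext
    (by
      change _ = f a
      rw [fst_transpose, comp_apply, geoZero_incl])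
    (by
      change _ = (0 : B)
      rw [snd_transpose, comp_apply, geoZero_d, map_zero])

lemma transpose_transpose_lift_comp (f : (geoTangent F).obj A ⟶ B) :
    transpose (transpose (geoLift A ≫ f)) a = Semidirect.algL (transpose f a) :=
  algTangent_ext
    (algTangent_ext
      (by
        change _ = fst (transpose f a)
        simp only [fst_transpose, comp_apply, geoLift_incl_incl])
      (by
        change _ = (0 : B)
        simp only [fst_transpose, snd_transpose, comp_apply, geoLift_d_incl, map_zero]))
    (algTangent_ext
      (by
        change _ = (0 : B)
        simp only [fst_transpose, snd_transpose, comp_apply, geoLift_incl_d, map_zero])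
      (by
        change _ = snd (transpose f a)
        simp only [snd_transpose, comp_apply, geoLift_d_d]))

lemma transpose_transpose_flip_comp
    (f : (geoTangent F).obj ((geoTangent F).obj A) ⟶ B) :
    transpose (transpose (geoFlip A ≫ f)) a = Semidirect.algC (transpose (transpose f) a) :=
  algTangent_ext
    (algTangent_ext
      (by
        change _ = fst (fst (transpose (transpose f) a))
        simp only [fst_transpose, comp_apply, geoFlip_incl_incl])
      (by
        change _ = fst (snd (transpose (transpose f) a))
        simp only [fst_transpose, snd_transpose, comp_apply, geoFlip_d_incl]))
    (algTangent_ext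
      (by
        change _ = snd (fst (transpose (transpose f) a))
        simp only [fst_transpose, snd_transpose, comp_apply, geoFlip_incl_d])
      (by
        change _ = snd (snd (transpose (transpose f) a))
        simp only [snd_transpose, comp_apply, geoFlip_d_d]))

lemma transpose_neg_comp (f : (geoTangent F).obj A ⟶ B) :
    transpose (geoNeg A ≫ f) a = Semidirect.algN (transpose f a) :=
  algTangent_ext
    (by
      change _ = fst (transpose f a)
      rw [fst_transpose, fst_transpose, comp_apply, geoNeg_incl])
    (by
      change _ = -snd (transpose f a)
      rw [snd_transpose, snd_transpose, comp_apply, geoNeg_d, map_neg])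

end Mates

variable (F) in
/-- The geometric tangent structure on the opposite of the category of divided power algebras. -/
noncomputable def geoRosicky : RosickyTangentStructure (geoTangent.{u} F).op :=
  (geoCotangentStructure F).toRosicky (geoAdj F)

lemma isAdjointTangentStructure_geoRosicky :
    IsAdjointTangentStructure (geoRosicky F) (geoAdj F) where
  p A B f a := by
    rw [homEquiv_geoAdj]
    rfl
  s A B f a := by
    rw [homEquiv_geoAdj, homEquiv_geoAdj, homEquiv_geoAdj]
    exact transpose_sum_comp a f
  z A B f a := by
    rw [homEquiv_geoAdj]
    exact transpose_zero_comp a f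
  l A B f a := by
    rw [homEquiv_geoAdj, homEquiv_geoAdj, homEquiv_geoAdj]
    exact transpose_transpose_lift_comp a f
  c A B f a := by
    simp only [homEquiv_geoAdj]
    exact transpose_transpose_flip_comp a f
  n A B f a := by
    rw [homEquiv_geoAdj, homEquiv_geoAdj]
    exact transpose_neg_comp a f

end DPAlg

theorem mainTheorem3 (F : Type u) [Field F] :
    ∃ (𝕋 : RosickyTangentStructure (geoTangent.{u} F).op) (adj : geoTangent F ⊣ algTangent F),
      -- `T° ⊣ T`, with unit `a ↦ (a, d a)`, and `𝕋` is adjoint to the algebraic tangent structure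
      (∀ (A : DPAlg.{u} F) (a : A),
        adj.unit.app A a = ((geoIncl A a, geoD A a) : Semidirect ((geoTangent F).obj A))) ∧
      IsAdjointTangentStructure 𝕋 adj ∧
      -- the structure maps, read in the category of divided power algebras, on generators
      ∀ (A : DPAlg.{u} F) (a : A),
        -- projection: `a ↦ a`
        𝕋.coP A a = geoIncl A a ∧
        -- sum: `a ↦ a`, `d a ↦ d₁ a + d₂ a`
        𝕋.coS A (geoIncl A a) = 𝕋.coBase 2 A a ∧
        𝕋.coS A (geoD A a) = 𝕋.coQ 2 0 A (geoD A a) + 𝕋.coQ 2 1 A (geoD A a) ∧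
        -- zero: `a ↦ a`, `d a ↦ 0`
        𝕋.coZ A (geoIncl A a) = a ∧
        𝕋.coZ A (geoD A a) = 0 ∧
        -- vertical lift: `a ↦ a`, `d a ↦ 0`, `d' a ↦ 0`, `d' d a ↦ d a`
        𝕋.coL A (geoIncl _ (geoIncl A a)) = geoIncl A a ∧
        𝕋.coL A (geoIncl _ (geoD A a)) = 0 ∧
        𝕋.coL A (geoD _ (geoIncl A a)) = 0 ∧
        𝕋.coL A (geoD _ (geoD A a)) = geoD A a ∧
        -- canonical flip: `a ↦ a`, `d a ↦ d' a`, `d' a ↦ d a`, `d' d a ↦ d' d a`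
        𝕋.coC A (geoIncl _ (geoIncl A a)) = geoIncl _ (geoIncl A a) ∧
        𝕋.coC A (geoIncl _ (geoD A a)) = geoD _ (geoIncl A a) ∧
        𝕋.coC A (geoD _ (geoIncl A a)) = geoIncl _ (geoD A a) ∧
        𝕋.coC A (geoD _ (geoD A a)) = geoD _ (geoD A a) ∧
        -- negative: `a ↦ a`, `d a ↦ - d a`
        𝕋.coN A (geoIncl A a) = geoIncl A a ∧
        𝕋.coN A (geoD A a) = - geoD A a := by
  refine ⟨DPAlg.geoRosicky F, DPAlg.geoAdj F, fun A a => ?_,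
    DPAlg.isAdjointTangentStructure_geoRosicky, fun A a => ?_⟩
  · rw [DPAlg.unit_geoAdj]
    rfl
  · exact ⟨rfl, DPAlg.geoSum_incl A a, DPAlg.geoSum_d A a, DPAlg.geoZero_incl A a,
      DPAlg.geoZero_d A a, DPAlg.geoLift_incl_incl A a, DPAlg.geoLift_incl_d A a,
      DPAlg.geoLift_d_incl A a, DPAlg.geoLift_d_d A a, DPAlg.geoFlip_incl_incl A a,
      DPAlg.geoFlip_incl_d A a, DPAlg.geoFlip_d_incl A a, DPAlg.geoFlip_d_d A a,
      DPAlg.geoNeg_incl A a, DPAlg.geoNeg_d A a⟩
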